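/- Let $n\ge 1$ and let $\omega_1,\dots,\omega_n>0$ be pairwise distinct. Consider the system of $n$ linear oscillators $\dot x=Ax+Bu$, $x=(x_1,y_1,\dots,x_n,y_n)\in\mathbb R^{2n}$, $u\in\mathbb R$, that is, $\dot x_i=y_i$, $\dot y_i=-\omega_i^2x_i+u$ for $i=1,\dots,n$. For a momentum $p=(\xi_1,\eta_1,\dots,\xi_n,\eta_n)$ put $z_i=(\eta_i^2+\omega_i^{-2}\xi_i^2)^{1/2}$ and $$H(p)=\frac1{(2\pi)^n}\int_0^{2\pi}\!\!\cdots\int_0^{2\pi}\Bigl|\sum_{i=1}^n z_i\cos\varphi_i\Bigr|\,d\varphi_1\cdots d\varphi_n .$$ Let $\Omega=\{x:(p,x)\le H(p)\text{ for all }p\}$ be the convex body with support function $H$, and let $\rho$ be its Minkowski gauge, so that for $x\ne0$ one has $x=\rho(x)\phi$ with $\rho(x)>0$ and $\phi\in\partial\Omega$. For $x\neq 0$ let $p=p(x)$ be the solution of $\rho(x)^{-1}x=\frac{\partial H}{\partial p}(p)$, $H(p)=1$, and consider the feedback control $u(x)=-\operatorname{sign}(B,p(x))$, where $\operatorname{sign}0$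 may take any value in $[-1,1]$, and, for a number $U$ with $0<|U|\le1$, the control $u_U(x)=U\,u(x)$. A motion under the control $u_U$ is an absolutely continuous function satisfying $\dot x=Ax+Bu$ for almost every $t$ with measurable $u=u(t)$ such that, for almost every $t$, $u(t)$ is one of the values of $u_U(x(t))$. Call a pair of positive numbers $(C,c)$ admissible if every motion under the control $u=u_1$ from the level set $\rho=M$ to the level set $\rho=N$ which goes within the domain $\rho(x)\ge C$ in a time interval of integer length $T$ satisfies $T\le c(M-N)$. Then admissible pairs $C=C(A,B)$, $c=c(A,B)$, depending only on the system of oscillators, exist. Moreover, for every admissible pair $(C,c)$ and every $U$ with $0<|U|\le1$: if a motion under the control $u_U$ from the level set $\rho=M$ to the level set $\rho=N$ goes within the domain $\rho(x)\ge |U|\,C$ in a time interval of integer length $T$, then $$T\le\frac cU\,(M-N).$$ -/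

import Mathlib

noncomputable section

namespace Oscillators

/-- Phase space `ℝ^{2n}` of `n` oscillators, with its Euclidean structure. The coordinate `(0, i)`
is the position and the coordinate `(1, i)` the velocity of the `i`-th oscillator. Momenta
(dual vectors) are identified with elements of the same space through the inner product:
`p (0, i) = ξ_i` is dual to the position, `p (1, i) = η_i` to the velocity. -/
abbrev Phase (n : ℕ) : Type := EuclideanSpace ℝ (Fin 2 × Fin n)

/-- The matrix `A`: block diagonal with the blocks `(0 1; -ω_i² 0)`. -/
def A {n : ℕ} (ω : Fin n → ℝ) : Matrix (Fin 2 × Fin n) (Fin 2 × Fin n) ℝ :=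
  Matrix.blockDiagonal fun i => !![0, 1; -(ω i) ^ 2, 0]

/-- The vector `B = (0, 1, …, 0, 1)^*`: the common control acts on every velocity. -/
def B (n : ℕ) : Phase n :=
  WithLp.toLp 2 fun j => if j.1 = 1 then 1 else 0

/-- The amplitudes `z_i = (η_i² + ω_i⁻² ξ_i²)^{1/2}` of a momentum. -/
def amplitude {n : ℕ} (ω : Fin n → ℝ) (p : Phase n) (i : Fin n) : ℝ :=
  Real.sqrt ((p (1, i)) ^ 2 + ((ω i) ^ 2)⁻¹ * (p (0, i)) ^ 2)

/-- The mean value of `|∑ z_i cos φ_i|` over the torus `[0, 2π]^n`. -/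
def meanAbs {n : ℕ} (z : Fin n → ℝ) : ℝ :=
  ((2 * Real.pi) ^ n)⁻¹ *
    ∫ φ in Set.Icc (fun _ : Fin n => (0 : ℝ)) (fun _ => 2 * Real.pi),
      |∑ i, z i * Real.cos (φ i)|

/-- The support function `H_Ω` of the limit shape `Ω`. -/
def H {n : ℕ} (ω : Fin n → ℝ) (p : Phase n) : ℝ :=
  meanAbs (amplitude ω p)

/-- The convex body `Ω` whose support function is `H`. -/
def Omega {n : ℕ} (ω : Fin n → ℝ) : Set (Phase n) :=
  {x | ∀ p : Phase n, inner ℝ p x ≤ H ω p}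

/-- The polar radius `ρ`: `x = ρ φ` with `ρ > 0` and `φ ∈ ∂Ω` for `x ≠ 0`
(the Minkowski gauge of `Ω`). -/
def rho {n : ℕ} (ω : Fin n → ℝ) (x : Phase n) : ℝ :=
  gauge (Omega ω) x

/-- `p` is the momentum at `x`: it solves `ρ(x)⁻¹ x = (∂H/∂p)(p)`, and it is normalized by
`H(p) = 1` (the equation itself determines `p` up to a positive factor). -/
def IsMomentum {n : ℕ} (ω : Fin n → ℝ) (x p : Phase n) : Prop :=
  H ω p = 1 ∧ HasGradientAt (H ω) ((rho ω x)⁻¹ • x) p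

/-- The values of the feedback control `u(x) = -sign (B, p(x))`, where `sign 0` may be any number
of `[-1, 1]` (Filippov convention for the discontinuous control, which allows for singular
motions along the switching surface). -/
def feedback {n : ℕ} (ω : Fin n → ℝ) (x : Phase n) : Set ℝ :=
  {v | |v| ≤ 1 ∧ ∀ p : Phase n, IsMomentum ω x p →
    v * inner ℝ (B n) p = -|inner ℝ (B n) p|}

/-- `x` is, on the time interval `[a, b]`, a motion of `ẋ = A x + B u` under the control
`u = U · u(x)` with `u(x)` the feedback control above. Since the control is discontinuous,
the equation is understood in the integral form (`x` is absolutely continuous and satisfies the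
equation almost everywhere). -/
def IsMotion {n : ℕ} (ω : Fin n → ℝ) (U : ℝ) (x : ℝ → Phase n) (a b : ℝ) : Prop :=
  ContinuousOn x (Set.Icc a b) ∧
  ∃ v : ℝ → ℝ, Measurable v ∧
    (∀ᵐ t ∂MeasureTheory.volume, t ∈ Set.Icc a b → v t ∈ feedback ω (x t)) ∧
    ∀ t ∈ Set.Icc a b,
      x t = x a + ∫ s in a..t, (Matrix.toEuclideanLin (A ω) (x s) + (U * v s) • B n)

/-- `(C, c)` are admissible constants for the unreduced control (`U = 1`): a motion from the level
set `ρ = M` to the level set `ρ = N` that goes within the domain `ρ ≥ C` in a time interval of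
integer length `T` satisfies `T ≤ c (M - N)`. -/
def AreEfficiencyConstants {n : ℕ} (ω : Fin n → ℝ) (C c : ℝ) : Prop :=
  ∀ (T : ℕ) (a M N : ℝ) (x : ℝ → Phase n),
    IsMotion ω 1 x a (a + T) →
    (∀ t ∈ Set.Icc a (a + T), C ≤ rho ω (x t)) →
    rho ω (x a) = M → rho ω (x (a + T)) = N →
    (T : ℝ) ≤ c * (M - N)

end Oscillators

end

noncomputable section

open MeasureTheory Set Filter Topology

namespace Oscillators

/-! Rotating each phase writes `H` as the mean of |linear form in `p`| over the torus, so `H` is a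
norm. Since a nonzero trigonometric form vanishes only on a null set, `H` is differentiable off 0;
equality in the triangle inequality forces proportional forms, so `H` is strictly, hence by
compactness uniformly, convex. Its dual norm is `ρ`, and a momentum at `x` is a normalized `p`
attaining `(p, x) = ρ(x)`.

For existence, carry the momentum of the endpoint back along the dual flow, an isometry of `H`. The
pairing with the motion then changes only through the control, by at most a constant in unit time.
So far from 0 the transported momentum nearly attains `ρ`, and uniform convexity puts it near the
true momentum (`exists_rho_drop`). The feedback therefore acts almost as `-sign` of the transported
pairing with `B`, and observability (`exists_observability`, where distinct frequencies enter) makes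
`ρ` drop by a fixed amount per unit of time.

The bound for `U` is symmetry. Dilation by `1/U` turns the control `u_U` into `u_1` because the
feedback is homogeneous of degree 0; for negative `U`, time reversal combined with reflection of
velocities first changes the sign of `U`. -/

instance fact_two_pi_pos : Fact (0 < 2 * Real.pi) := ⟨Real.two_pi_pos⟩

/-! ### Averages over the box and over the torus -/

/-- The torus `(ℝ / 2πℤ)^n`. -/
abbrev Torus (n : ℕ) : Type := Fin n → AddCircle (2 * Real.pi)

/-- The fundamental box `[0, 2π]^n`. -/
abbrev box (n : ℕ) : Set (Fin n → ℝ) := Icc (fun _ => (0 : ℝ)) (fun _ => 2 * Real.pi)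

theorem setIntegral_box_eq {n : ℕ} (G : Torus n → ℝ) (hG : Continuous G) :
    ∫ φ in box n, G (fun i => (φ i : AddCircle (2 * Real.pi))) = ∫ θ, G θ := by
  have hmp : MeasurePreserving
      (fun (φ : Fin n → ℝ) i => (QuotientAddGroup.mk (φ i) : AddCircle (2 * Real.pi)))
      (Measure.pi fun _ : Fin n => (volume : Measure ℝ).restrict (Ioc 0 (0 + 2 * Real.pi)))
      (Measure.pi fun _ : Fin n => (volume : Measure (AddCircle (2 * Real.pi)))) :=
    measurePreserving_pi _ _ fun _ => AddCircle.measurePreserving_mk (2 * Real.pi) 0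
  have hbox : (volume : Measure (Fin n → ℝ)).restrict (box n) =
      Measure.pi fun _ : Fin n => (volume : Measure ℝ).restrict (Ioc 0 (0 + 2 * Real.pi)) := by
    rw [box, ← pi_univ_Icc, volume_pi, Measure.restrict_pi_pi]
    congr 1
    funext i
    rw [zero_add]
    exact (Measure.restrict_congr_set Ioc_ae_eq_Icc).symm
  rw [hbox, volume_pi, ← hmp.map_eq, integral_map hmp.measurable.aemeasurable
    hG.aestronglyMeasurable]

/-- The cosine on the circle. -/
def cosC (θ : AddCircle (2 * Real.pi)) : ℝ := Real.cos_periodic.lift θ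

/-- The sine on the circle. -/
def sinC (θ : AddCircle (2 * Real.pi)) : ℝ := Real.sin_periodic.lift θ

@[simp] theorem cosC_coe (x : ℝ) : cosC (x : AddCircle (2 * Real.pi)) = Real.cos x := rfl
@[simp] theorem sinC_coe (x : ℝ) : sinC (x : AddCircle (2 * Real.pi)) = Real.sin x := rfl

theorem continuous_cosC : Continuous cosC := Real.continuous_cos.quotient_liftOn' _
theorem continuous_sinC : Continuous sinC := Real.continuous_sin.quotient_liftOn' _

/-! ### The norm `H` as a mean of absolute values of linear forms -/

variable {n : ℕ}

/-- The trigonometric form whose mean absolute value is `H ω p`. -/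
def form (ω : Fin n → ℝ) (p : Phase n) (φ : Fin n → ℝ) : ℝ :=
  ∑ i, (p (1, i) * Real.cos (φ i) + (ω i)⁻¹ * p (0, i) * Real.sin (φ i))

/-- The same form on the torus. -/
def formT (ω : Fin n → ℝ) (p : Phase n) (θ : Torus n) : ℝ :=
  ∑ i, (p (1, i) * cosC (θ i) + (ω i)⁻¹ * p (0, i) * sinC (θ i))

theorem formT_coe (ω : Fin n → ℝ) (p : Phase n) (φ : Fin n → ℝ) :
    formT ω p (fun i => (φ i : AddCircle (2 * Real.pi))) = form ω p φ := rfl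

theorem continuous_formT (ω : Fin n → ℝ) (p : Phase n) : Continuous (formT ω p) := by
  unfold formT
  have h1 := continuous_cosC
  have h2 := continuous_sinC
  fun_prop

theorem continuous_form (ω : Fin n → ℝ) (p : Phase n) : Continuous (form ω p) := by
  unfold form
  fun_prop

/-- Polar coordinates of an oscillator's momentum. -/
theorem exists_phase (a b : ℝ) : ∃ α : ℝ,
    a = Real.sqrt (a ^ 2 + b ^ 2) * Real.cos α ∧ b = Real.sqrt (a ^ 2 + b ^ 2) * Real.sin α := by
  refine ⟨Complex.arg ⟨a, b⟩, ?_⟩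
  have h : ‖(⟨a, b⟩ : ℂ)‖ = Real.sqrt (a ^ 2 + b ^ 2) := by
    rw [Complex.norm_def, Complex.normSq_mk]; ring_nf
  rw [← h]
  exact ⟨(Complex.norm_mul_cos_arg ⟨a, b⟩).symm, (Complex.norm_mul_sin_arg ⟨a, b⟩).symm⟩

theorem exists_phase_amplitude (ω : Fin n → ℝ) (p : Phase n) : ∃ α : Fin n → ℝ, ∀ i,
    p (1, i) = amplitude ω p i * Real.cos (α i) ∧
    (ω i)⁻¹ * p (0, i) = amplitude ω p i * Real.sin (α i) := by
  choose α hα using fun i => exists_phase (p (1, i)) ((ω i)⁻¹ * p (0, i))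
  refine ⟨α, fun i => ?_⟩
  have : amplitude ω p i = Real.sqrt (p (1, i) ^ 2 + ((ω i)⁻¹ * p (0, i)) ^ 2) := by
    rw [amplitude, mul_pow, inv_pow]
  rw [this]
  exact hα i

/-- Each summand of the form is `z_i cos (φ_i - α_i)`, and translation invariance on the torus
absorbs the phases `α_i`. The integrand becomes the absolute value of something linear in `p`,
unlike the amplitudes. -/
theorem H_eq_torus (ω : Fin n → ℝ) (p : Phase n) :
    H ω p = ((2 * Real.pi) ^ n)⁻¹ * ∫ θ, |formT ω p θ| := by
  obtain ⟨α, hα⟩ := exists_phase_amplitude ω p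
  rw [H, meanAbs]
  congr 1
  have hc := continuous_cosC
  have h1 := setIntegral_box_eq (n := n) (fun θ => |∑ i, amplitude ω p i * cosC (θ i)|)
    (by fun_prop)
  simp only [cosC_coe] at h1
  rw [h1, ← integral_sub_right_eq_self _ (fun i => (α i : AddCircle (2 * Real.pi)))]
  refine integral_congr_ae (Eventually.of_forall fun θ => ?_)
  have : ∃ φ : Fin n → ℝ, θ = fun i => (φ i : AddCircle (2 * Real.pi)) := by
    choose φ hφ using fun i => QuotientAddGroup.mk_surjective (θ i)
    exact ⟨φ, funext fun i => (hφ i).symm⟩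
  obtain ⟨φ, rfl⟩ := this
  simp only [formT_coe, form, Pi.sub_apply, ← AddCircle.coe_sub, cosC_coe, Real.cos_sub]
  congr 1
  refine Finset.sum_congr rfl fun i _ => ?_
  rw [(hα i).1, (hα i).2]
  ring

theorem H_eq_box (ω : Fin n → ℝ) (p : Phase n) :
    H ω p = ((2 * Real.pi) ^ n)⁻¹ * ∫ φ in box n, |form ω p φ| := by
  rw [H_eq_torus, ← setIntegral_box_eq _ (continuous_formT ω p).abs]
  rfl

/-- An analytic function that is not identically zero has a codiscrete nonvanishing set; the angles
0, π, π/2 rule out the zero function. -/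
theorem trig_ae_ne_zero (k a b y : ℝ) (h : a ≠ 0 ∨ b ≠ 0) :
    ∀ᵐ s : ℝ, k + (a * Real.cos (y + s) + b * Real.sin (y + s)) ≠ 0 := by
  have han : AnalyticOnNhd ℝ (fun s : ℝ => k + (a * Real.cos (y + s) + b * Real.sin (y + s)))
      univ := by
    intro s _
    fun_prop
  obtain ⟨x, hx⟩ : ∃ s : ℝ, k + (a * Real.cos (y + s) + b * Real.sin (y + s)) ≠ 0 := by
    by_contra! hcon
    have h0 := hcon (0 - y)
    have h1 := hcon (Real.pi - y)
    have h2 := hcon (Real.pi / 2 - y)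
    simp only [add_sub_cancel, Real.cos_zero, Real.sin_zero, Real.cos_pi, Real.sin_pi,
      Real.cos_pi_div_two, Real.sin_pi_div_two] at h0 h1 h2
    rcases h with h | h <;> apply h <;> linarith
  have := han.preimage_zero_mem_codiscrete hx
  have h2 := ae_restrict_le_codiscreteWithin (μ := (volume : Measure ℝ)) MeasurableSet.univ this
  rw [Measure.restrict_univ] at h2
  exact h2

/-- Fubini along the phase of one oscillator with nonzero momentum reduces this to one variable. -/
theorem form_ae_ne_zero {ω : Fin n → ℝ} (hω : ∀ i, 0 < ω i) {p : Phase n} (hp : p ≠ 0) :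
    ∀ᵐ φ : Fin n → ℝ, form ω p φ ≠ 0 := by
  obtain ⟨i, hi⟩ : ∃ i, p (1, i) ≠ 0 ∨ (ω i)⁻¹ * p (0, i) ≠ 0 := by
    by_contra! hcon
    apply hp
    ext ⟨j, i⟩
    have h := hcon i
    have h2 : p (0, i) = 0 := by
      rcases mul_eq_zero.1 h.2 with h3 | h3
      · exact absurd h3 (inv_ne_zero (hω i).ne')
      · exact h3
    fin_cases j
    · exact h2
    · exact h.1
  let L : ℝ →ₗ[ℝ] (Fin n → ℝ) := LinearMap.single ℝ (fun _ => ℝ) i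
  refine ae_mem_of_ae_add_linearMap_mem L volume volume (s := {φ | form ω p φ ≠ 0}) ?_ ?_
  · exact (isOpen_ne_fun (continuous_form ω p) continuous_const).measurableSet
  intro y
  filter_upwards [trig_ae_ne_zero (∑ j ∈ Finset.univ.erase i,
    (p (1, j) * Real.cos (y j) + (ω j)⁻¹ * p (0, j) * Real.sin (y j))) _ _ (y i) hi] with s hs
  have : form ω p (y + L s) = (∑ j ∈ Finset.univ.erase i,
    (p (1, j) * Real.cos (y j) + (ω j)⁻¹ * p (0, j) * Real.sin (y j))) +
      (p (1, i) * Real.cos (y i + s) + (ω i)⁻¹ * p (0, i) * Real.sin (y i + s)) := by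
    rw [form, ← Finset.sum_erase_add _ _ (Finset.mem_univ i)]
    congr 1
    · refine Finset.sum_congr rfl fun j hj => ?_
      have : L s j = 0 := by simp [L, Finset.ne_of_mem_erase hj]
      simp [this]
    · simp [L]
  simpa [this] using hs

/-- `form ω · φ` as a continuous linear functional. -/
def formL (ω : Fin n → ℝ) (φ : Fin n → ℝ) : Phase n →L[ℝ] ℝ :=
  ∑ i, (Real.cos (φ i) • (EuclideanSpace.proj (1, i) : Phase n →L[ℝ] ℝ) +
    ((ω i)⁻¹ * Real.sin (φ i)) • (EuclideanSpace.proj (0, i) : Phase n →L[ℝ] ℝ))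

theorem formL_apply (ω : Fin n → ℝ) (φ : Fin n → ℝ) (p : Phase n) :
    formL ω φ p = form ω p φ := by
  simp only [formL, form, FunLike.coe_sum, Finset.sum_apply, FunLike.coe_add, Pi.add_apply,
    FunLike.coe_smul, Pi.smul_apply, smul_eq_mul]
  refine Finset.sum_congr rfl fun i _ => ?_
  rw [show (EuclideanSpace.proj (1, i) : Phase n →L[ℝ] ℝ) p = p (1, i) from rfl,
    show (EuclideanSpace.proj (0, i) : Phase n →L[ℝ] ℝ) p = p (0, i) from rfl]
  ring

theorem continuous_formL (ω : Fin n → ℝ) : Continuous (formL ω) := by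
  unfold formL
  fun_prop

theorem form_add (ω : Fin n → ℝ) (p q : Phase n) (φ : Fin n → ℝ) :
    form ω (p + q) φ = form ω p φ + form ω q φ := by
  simp only [← formL_apply, map_add]

theorem form_smul (ω : Fin n → ℝ) (c : ℝ) (p : Phase n) (φ : Fin n → ℝ) :
    form ω (c • p) φ = c * form ω p φ := by
  simp only [← formL_apply, map_smul, smul_eq_mul]

theorem Continuous.integrableOn_box {f : (Fin n → ℝ) → ℝ} (hf : Continuous f) :
    IntegrableOn f (box n) :=
  hf.continuousOn.integrableOn_compact isCompact_Icc

theorem integrableOn_form (ω : Fin n → ℝ) (p : Phase n) :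
    IntegrableOn (fun φ => |form ω p φ|) (box n) :=
  Continuous.integrableOn_box (continuous_form ω p).abs

theorem two_pi_pow_pos : 0 < ((2 * Real.pi) ^ n)⁻¹ := by positivity

theorem H_nonneg (ω : Fin n → ℝ) (p : Phase n) : 0 ≤ H ω p := by
  rw [H_eq_box]
  exact mul_nonneg two_pi_pow_pos.le (integral_nonneg fun _ => abs_nonneg _)

theorem H_smul (ω : Fin n → ℝ) (c : ℝ) (p : Phase n) : H ω (c • p) = |c| * H ω p := by
  simp only [H_eq_box, form_smul, abs_mul, integral_const_mul]
  ring

theorem H_zero (ω : Fin n → ℝ) : H ω 0 = 0 := by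
  simpa using H_smul ω 0 0

theorem H_add_le (ω : Fin n → ℝ) (p q : Phase n) : H ω (p + q) ≤ H ω p + H ω q := by
  simp only [H_eq_box, ← mul_add]
  refine mul_le_mul_of_nonneg_left ?_ two_pi_pow_pos.le
  rw [← integral_add (integrableOn_form ω p) (integrableOn_form ω q)]
  refine integral_mono (integrableOn_form ω _)
    ((integrableOn_form ω p).add (integrableOn_form ω q)) fun φ => ?_
  simp only [form_add]
  exact abs_add_le _ _

theorem H_pos {ω : Fin n → ℝ} (hω : ∀ i, 0 < ω i) {p : Phase n} (hp : p ≠ 0) : 0 < H ω p := by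
  refine lt_of_le_of_ne (H_nonneg ω p) fun h => ?_
  rw [H_eq_box, eq_comm, mul_eq_zero, or_iff_right two_pi_pow_pos.ne',
    integral_eq_zero_iff_of_nonneg (fun _ => abs_nonneg _) (integrableOn_form ω p)] at h
  have h2 := ae_restrict_of_ae (s := box n) (form_ae_ne_zero hω hp)
  have h3 : ∀ᵐ _ ∂(volume : Measure (Fin n → ℝ)).restrict (box n), False := by
    filter_upwards [h, h2] with φ h h2
    exact h2 (by simpa using h)
  have h4 : volume (box n) = 0 :=
    Measure.restrict_eq_zero.1 (ae_eq_bot.1 (eventually_false_iff_eq_bot.1 h3))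
  rw [box, Real.volume_Icc_pi, Finset.prod_eq_zero_iff] at h4
  obtain ⟨i, _, hi⟩ := h4
  rw [ENNReal.ofReal_eq_zero] at hi
  linarith [Real.two_pi_pos]

/-- Differentiation under the integral: the integrand is Lipschitz in `p`, and differentiable at `p`
unless the form vanishes there, which happens on a null set of phases. -/
theorem differentiableAt_H {ω : Fin n → ℝ} (hω : ∀ i, 0 < ω i) {p : Phase n} (hp : p ≠ 0) :
    DifferentiableAt ℝ (H ω) p := by
  have key := hasFDerivAt_integral_of_dominated_loc_of_lip (𝕜 := ℝ)
    (μ := (volume : Measure (Fin n → ℝ)).restrict (box n))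
    (F := fun p φ => |form ω p φ|) (x₀ := p) (s := univ)
    (F' := fun φ => (SignType.sign (form ω p φ) : ℝ) • formL ω φ)
    (bound := fun φ => ‖formL ω φ‖) univ_mem
    (Eventually.of_forall fun q => (continuous_form ω q).abs.aestronglyMeasurable)
    (integrableOn_form ω p) ?_ ?_ (Continuous.integrableOn_box (continuous_formL ω).norm) ?_
  · have : H ω = fun p => ((2 * Real.pi) ^ n)⁻¹ * ∫ φ in box n, |form ω p φ| :=
      funext fun p => H_eq_box ω p
    rw [this]
    exact key.2.differentiableAt.const_mul _
  · have h1 : Measurable fun x : ℝ => ((SignType.sign x : SignType) : ℝ) := by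
      have : (fun x : ℝ => ((SignType.sign x : SignType) : ℝ)) =
          fun x => if 0 < x then 1 else if x < 0 then -1 else 0 := by
        funext x
        simp only [sign_apply]
        split_ifs <;> simp
      rw [this]
      exact Measurable.ite measurableSet_Ioi measurable_const
        (Measurable.ite measurableSet_Iio measurable_const measurable_const)
    have h2 := (h1.comp (continuous_form ω p).measurable).aestronglyMeasurable
      (μ := (volume : Measure (Fin n → ℝ)).restrict (box n))
    exact h2.smul (continuous_formL ω).aestronglyMeasurable
  · refine Eventually.of_forall fun φ => LipschitzOnWith.of_dist_le_mul fun x _ y _ => ?_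
    simp only [dist_eq_norm, Real.norm_eq_abs, Real.coe_nnabs, abs_norm, ← formL_apply]
    refine (abs_abs_sub_abs_le _ _).trans ?_
    rw [← map_sub]
    exact (formL ω φ).le_opNorm _
  · filter_upwards [ae_restrict_of_ae (s := box n) (form_ae_ne_zero hω hp)] with φ hφ
    simp only [← formL_apply] at hφ ⊢
    have := (hasDerivAt_abs hφ).comp_hasFDerivAt p (formL ω φ).hasFDerivAt
    exact this

theorem continuous_H (ω : Fin n → ℝ) : Continuous (H ω) := by
  have : ConvexOn ℝ univ (H ω) := by
    refine ⟨convex_univ, fun x _ y _ a b ha hb _ => (H_add_le ω _ _).trans_eq ?_⟩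
    rw [H_smul, H_smul, abs_of_nonneg ha, abs_of_nonneg hb, smul_eq_mul, smul_eq_mul]
  exact continuousOn_univ.1 (this.continuousOn isOpen_univ)

theorem exists_le_H {ω : Fin n → ℝ} (hω : ∀ i, 0 < ω i) :
    ∃ m : ℝ, 0 < m ∧ ∀ p : Phase n, m * ‖p‖ ≤ H ω p := by
  have hS : IsCompact (Metric.sphere (0 : Phase n) 1) := isCompact_sphere _ _
  rcases (Metric.sphere (0 : Phase n) 1).eq_empty_or_nonempty with he | hne
  · refine ⟨1, one_pos, fun p => ?_⟩
    have : p = 0 := by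
      by_contra hp
      have : ‖p‖⁻¹ • p ∈ Metric.sphere (0 : Phase n) 1 := by
        simp [norm_smul, hp]
      simp [he] at this
    simp [this, H_nonneg]
  · obtain ⟨q, hq, hmin⟩ := hS.exists_isMinOn hne (continuous_H ω).continuousOn
    have hq0 : q ≠ 0 := by
      rintro rfl
      simp at hq
    refine ⟨H ω q, H_pos hω hq0, fun p => ?_⟩
    rcases eq_or_ne p 0 with rfl | hp
    · simp [H_nonneg]
    · have : ‖p‖⁻¹ • p ∈ Metric.sphere (0 : Phase n) 1 := by
        simp [norm_smul, hp]
      have h2 := hmin this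
      simp only [mem_ofPred_eq, H_smul, abs_inv, abs_norm] at h2
      have h3 : 0 < ‖p‖ := norm_pos_iff.2 hp
      calc H ω q * ‖p‖ ≤ (‖p‖⁻¹ * H ω p) * ‖p‖ := by gcongr
        _ = H ω p := by field_simp

theorem isCompact_H_eq_one {ω : Fin n → ℝ} (hω : ∀ i, 0 < ω i) :
    IsCompact {p : Phase n | H ω p = 1} := by
  obtain ⟨m, hm, h⟩ := exists_le_H hω
  refine Metric.isCompact_of_isClosed_isBounded
    (isClosed_eq (continuous_H ω) continuous_const) ?_
  refine (Metric.isBounded_closedBall (x := (0 : Phase n)) (r := m⁻¹)).subset fun p hp => ?_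
  rw [mem_closedBall_zero_iff]
  have := h p
  rw [show H ω p = 1 from hp] at this
  rwa [← mul_le_mul_iff_of_pos_left hm, mul_inv_cancel₀ hm.ne']

/-! ### Strict and uniform convexity of `H` -/

/-- Two trigonometric forms with the same sign everywhere are proportional. -/
theorem proportional_of_trig_mul_nonneg {z c d : Fin n → ℝ} (hz : ∀ i, 0 ≤ z i) (hz0 : z ≠ 0)
    (h : ∀ ψ : Fin n → ℝ, 0 ≤ (∑ i, z i * Real.cos (ψ i)) *
      ∑ i, (c i * Real.cos (ψ i) + d i * Real.sin (ψ i))) :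
    d = 0 ∧ ∃ l : ℝ, ∀ i, c i = l * z i := by
  have hZ : 0 < ∑ i, z i := by
    obtain ⟨i, hi⟩ := Function.ne_iff.1 hz0
    exact Finset.sum_pos' (fun i _ => hz i) ⟨i, Finset.mem_univ i, lt_of_le_of_ne (hz i) hi.symm⟩
  -- At `ψ_i = σ_i (π/2 - ε)` the first sum is `sin ε · ∑ z_i`, which changes sign at `ε = 0`. The
  -- second must then vanish at `ε = 0`, where it equals `∑ d_i σ_i`.
  have hd : ∀ σ : Fin n → ℝ, (∀ i, σ i = 1 ∨ σ i = -1) → ∑ i, d i * σ i = 0 := by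
    intro σ hσ
    have key : ∀ ε : ℝ, 0 ≤ (Real.sin ε * ∑ i, z i) *
        (Real.sin ε * ∑ i, c i + Real.cos ε * ∑ i, d i * σ i) := by
      intro ε
      have := h fun i => σ i * (Real.pi / 2 - ε)
      convert this using 2
      · rw [Finset.mul_sum]
        refine Finset.sum_congr rfl fun i _ => ?_
        rcases hσ i with h | h <;> rw [h]
        · rw [one_mul, Real.cos_pi_div_two_sub]; ring
        · rw [neg_one_mul, Real.cos_neg, Real.cos_pi_div_two_sub]; ring
      · rw [Finset.mul_sum, Finset.mul_sum, ← Finset.sum_add_distrib]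
        refine Finset.sum_congr rfl fun i _ => ?_
        rcases hσ i with h | h <;> rw [h]
        · rw [one_mul, Real.cos_pi_div_two_sub, Real.sin_pi_div_two_sub]; ring
        · rw [neg_one_mul, Real.cos_neg, Real.sin_neg, Real.cos_pi_div_two_sub,
            Real.sin_pi_div_two_sub]; ring
    have hcont : Continuous fun ε : ℝ =>
        Real.sin ε * ∑ i, c i + Real.cos ε * ∑ i, d i * σ i := by fun_prop
    have hval : (fun ε : ℝ => Real.sin ε * ∑ i, c i + Real.cos ε * ∑ i, d i * σ i) 0 =
      ∑ i, d i * σ i := by simp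
    apply le_antisymm
    · rw [← hval]
      refine le_of_tendsto (hcont.continuousWithinAt (s := Iio 0)) ?_
      filter_upwards [Ioo_mem_nhdsLT (neg_lt_zero.2 Real.pi_pos)] with ε hε
      have hs : Real.sin ε < 0 := Real.sin_neg_of_neg_of_neg_pi_lt hε.2 hε.1
      by_contra! hcon
      exact absurd (key ε) (not_le.2 (mul_neg_of_neg_of_pos (mul_neg_of_neg_of_pos hs hZ) hcon))
    · rw [← hval]
      refine ge_of_tendsto (hcont.continuousWithinAt (s := Ioi 0)) ?_
      filter_upwards [Ioo_mem_nhdsGT Real.pi_pos] with ε hε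
      have hs : 0 < Real.sin ε := Real.sin_pos_of_pos_of_lt_pi hε.1 hε.2
      exact nonneg_of_mul_nonneg_right (key ε) (mul_pos hs hZ)
  have hd0 : d = 0 := by
    funext i
    have h1 := hd (fun _ => 1) fun _ => Or.inl rfl
    have h2 := hd (fun j => if j = i then -1 else 1) fun j => by
      by_cases hj : j = i <;> simp [hj]
    have h3 : ∑ j, d j * (1 : ℝ) - ∑ j, d j * (if j = i then (-1 : ℝ) else 1) = 2 * d i := by
      rw [← Finset.sum_sub_distrib]
      have : ∀ j, d j * (1 : ℝ) - d j * (if j = i then (-1 : ℝ) else 1) =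
          if j = i then 2 * d j else 0 := fun j => by split_ifs <;> ring
      rw [Finset.sum_congr rfl fun j _ => this j]
      simp
    rw [h1, h2] at h3
    simp only [Pi.zero_apply]
    linarith
  refine ⟨hd0, ?_⟩
  subst hd0
  -- With `d = 0` only the cosines matter. They fill the cube `[-1, 1]^n`, and homogeneity extends
  -- the inequality to all vectors.
  have hcube : ∀ a : Fin n → ℝ, 0 ≤ (∑ i, z i * a i) * ∑ i, c i * a i := by
    intro a
    obtain ⟨R, hR, hRa⟩ : ∃ R : ℝ, 0 < R ∧ ∀ i, |a i| ≤ R :=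
      ⟨∑ i, |a i| + 1, by positivity, fun i =>
        (Finset.single_le_sum (f := fun i => |a i|) (fun _ _ => abs_nonneg _)
          (Finset.mem_univ i)).trans (by linarith)⟩
    have h1 := h fun i => Real.arccos (a i / R)
    have h2 : ∀ i, Real.cos (Real.arccos (a i / R)) = a i / R := fun i => by
      have := abs_le.1 (hRa i)
      apply Real.cos_arccos
      · rw [le_div_iff₀ hR]; linarith
      · rw [div_le_one hR]; exact this.2
    simp only [h2, Pi.zero_apply, zero_mul, add_zero, ← mul_div_assoc, ← Finset.sum_div] at h1
    rw [div_mul_eq_mul_div, div_div] at h1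
    have h3 := mul_nonneg h1 (mul_pos hR hR).le
    rwa [div_mul_cancel₀ _ (mul_pos hR hR).ne'] at h3
  have hzz : 0 < ∑ i, z i * z i := by
    obtain ⟨i, hi⟩ := Function.ne_iff.1 hz0
    exact Finset.sum_pos' (fun i _ => mul_self_nonneg _)
      ⟨i, Finset.mem_univ i, mul_self_pos.2 hi⟩
  -- Orthogonal projection: `c - l z` is orthogonal to `z`, and `Q` below is its squared length.
  set l := (∑ i, z i * c i) / ∑ i, z i * z i with hl
  have hzb : ∑ i, z i * (c i - l * z i) = 0 := by
    have : ∑ i, z i * (c i - l * z i) = ∑ i, z i * c i - l * ∑ i, z i * z i := by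
      rw [Finset.mul_sum, ← Finset.sum_sub_distrib]
      exact Finset.sum_congr rfl fun i _ => by ring
    rw [this, hl, div_mul_cancel₀ _ hzz.ne', sub_self]
  have hcb : ∑ i, c i * (c i - l * z i) = ∑ i, (c i - l * z i) * (c i - l * z i) := by
    have : ∑ i, c i * (c i - l * z i) = ∑ i, (c i - l * z i) * (c i - l * z i) +
        l * ∑ i, z i * (c i - l * z i) := by
      rw [Finset.mul_sum, ← Finset.sum_add_distrib]
      exact Finset.sum_congr rfl fun i _ => by ring
    rw [this, hzb, mul_zero, add_zero]
  set Q := ∑ i, (c i - l * z i) * (c i - l * z i) with hQ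
  have hQ0 : 0 ≤ Q := Finset.sum_nonneg fun i _ => mul_self_nonneg _
  set S := ∑ i, c i * z i with hS
  have hlin : ∀ t : ℝ, 0 ≤ t * (t * S + Q) := by
    intro t
    have h1 := hcube fun i => t * z i + (c i - l * z i)
    have h2 : ∑ i, z i * (t * z i + (c i - l * z i)) = t * ∑ i, z i * z i := by
      rw [← add_zero (t * _), ← hzb, Finset.mul_sum, ← Finset.sum_add_distrib]
      exact Finset.sum_congr rfl fun i _ => by ring
    have h3 : ∑ i, c i * (t * z i + (c i - l * z i)) = t * S + Q := by
      rw [← hcb, hS, Finset.mul_sum, ← Finset.sum_add_distrib]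
      exact Finset.sum_congr rfl fun i _ => by ring
    rw [h2, h3] at h1
    by_contra! hcon
    have := mul_neg_of_neg_of_pos hcon hzz
    linarith [show t * (∑ i, z i * z i) * (t * S + Q) = t * (t * S + Q) * ∑ i, z i * z i by ring]
  have hQ1 : Q = 0 := by
    by_contra hne
    have hQp : 0 < Q := lt_of_le_of_ne hQ0 (Ne.symm hne)
    -- A negative `t` so small that `t S + Q ≥ Q / 2`, contradicting `hlin`.
    have h1 := hlin (-(Q / (2 * (|S| + 1))))
    have hS1 : 0 < |S| + 1 := by positivity
    have hpos : 0 < Q / (2 * (|S| + 1)) := by positivity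
    have h2 : -(Q / (2 * (|S| + 1))) * S + Q > 0 := by
      have : Q / (2 * (|S| + 1)) * S ≤ Q / 2 := by
        calc Q / (2 * (|S| + 1)) * S ≤ Q / (2 * (|S| + 1)) * (|S| + 1) := by
              gcongr
              linarith [le_abs_self S]
          _ = Q / 2 := by field_simp
      linarith
    have := mul_neg_of_neg_of_pos (neg_lt_zero.2 hpos) h2
    linarith
  refine ⟨l, fun i => ?_⟩
  have := (Finset.sum_eq_zero_iff_of_nonneg (fun i _ => mul_self_nonneg (c i - l * z i))).1
    (hQ.symm.trans hQ1) i (Finset.mem_univ i)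
  have := mul_self_eq_zero.1 this
  linarith

/-- Equality in the integrated triangle inequality forces it almost everywhere, and by continuity
everywhere. On the torus, Haar measure charges every open set, so no boundary points are lost. -/
theorem form_mul_nonneg_of_H_add_eq {ω : Fin n → ℝ} {p q : Phase n}
    (h : H ω (p + q) = H ω p + H ω q) (φ : Fin n → ℝ) : 0 ≤ form ω p φ * form ω q φ := by
  have hadd : ∀ θ, formT ω (p + q) θ = formT ω p θ + formT ω q θ := by
    intro θ
    simp only [formT, PiLp.add_apply, ← Finset.sum_add_distrib]
    exact Finset.sum_congr rfl fun i _ => by ring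
  have hint : ∀ p : Phase n, Integrable fun θ => |formT ω p θ| := fun p =>
    (continuous_formT ω p).abs.integrable_of_hasCompactSupport
      (HasCompactSupport.of_compactSpace _)
  have hzero : ∫ θ, (|formT ω p θ| + |formT ω q θ| - |formT ω (p + q) θ|) = 0 := by
    have e1 := integral_sub ((hint p).add (hint q)) (hint (p + q))
    have e2 := integral_add (hint p) (hint q)
    simp only [Pi.add_apply] at e1
    rw [e1, e2]
    simp only [H_eq_torus, ← mul_add] at h
    have := mul_left_cancel₀ two_pi_pow_pos.ne' h
    linarith
  have hc : Continuous fun θ => |formT ω p θ| + |formT ω q θ| - |formT ω (p + q) θ| :=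
    ((continuous_formT ω p).abs.add (continuous_formT ω q).abs).sub (continuous_formT ω _).abs
  rw [integral_eq_zero_iff_of_nonneg (f := fun θ => |formT ω p θ| + |formT ω q θ| -
    |formT ω (p + q) θ|) _ (((hint p).add (hint q)).sub (hint _))] at hzero
  · rw [show (0 : Torus n → ℝ) = fun _ => 0 from rfl,
      Continuous.ae_eq_iff_eq _ hc continuous_const] at hzero
    have := congrFun hzero fun i => (φ i : AddCircle (2 * Real.pi))
    simp only [hadd, formT_coe] at this
    have h2 : |form ω p φ + form ω q φ| = |form ω p φ| + |form ω q φ| := by linarith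
    rcases (abs_add_eq_add_abs_iff _ _).1 h2 with h | h
    · exact mul_nonneg h.1 h.2
    · exact mul_nonneg_of_nonpos_of_nonpos h.1 h.2
  · intro θ
    simp only [hadd, Pi.zero_apply, sub_nonneg]
    exact abs_add_le _ _

/-- Shifting by the phases of `p` makes its form a pure cosine sum; `c` and `d` are the coefficients
of `q` in these coordinates. Proportionality gives `q = l p`, and the three values of `H` leave only
`l = 1`. -/
theorem eq_of_H_add_eq_two {ω : Fin n → ℝ} (hω : ∀ i, 0 < ω i) {p q : Phase n}
    (hp : H ω p = 1) (hq : H ω q = 1) (h : H ω (p + q) = 2) : p = q := by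
  obtain ⟨α, hα⟩ := exists_phase_amplitude ω p
  have hsign := form_mul_nonneg_of_H_add_eq (ω := ω) (p := p) (q := q) (by rw [h, hp, hq]; norm_num)
  set c : Fin n → ℝ := fun i =>
    q (1, i) * Real.cos (α i) + (ω i)⁻¹ * q (0, i) * Real.sin (α i) with hc
  set d : Fin n → ℝ := fun i =>
    -q (1, i) * Real.sin (α i) + (ω i)⁻¹ * q (0, i) * Real.cos (α i) with hd
  have hz0 : amplitude ω p ≠ 0 := by
    intro h0
    rw [H, h0, meanAbs] at hp
    simp at hp
  obtain ⟨hd0, l, hl⟩ := proportional_of_trig_mul_nonneg (z := amplitude ω p) (c := c) (d := d)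
    (fun i => Real.sqrt_nonneg _) hz0 (fun ψ => by
      convert hsign (fun i => ψ i + α i) using 2
      · refine Finset.sum_congr rfl fun i _ => ?_
        rw [(hα i).1, (hα i).2, Real.cos_add, Real.sin_add]
        linear_combination (-amplitude ω p i * Real.cos (ψ i)) * Real.sin_sq_add_cos_sq (α i)
      · refine Finset.sum_congr rfl fun i _ => ?_
        simp only [hc, hd]
        rw [Real.cos_add, Real.sin_add]
        ring)
  have hqp : q = l • p := by
    ext ⟨j, i⟩
    have h1 := hl i
    have h2 : d i = 0 := congrFun hd0 i
    simp only [hc] at h1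
    simp only [hd] at h2
    have hs := Real.sin_sq_add_cos_sq (α i)
    have e1 : q (1, i) = l * p (1, i) := by
      rw [(hα i).1]
      linear_combination (Real.cos (α i)) * h1 - (Real.sin (α i)) * h2 - q (1, i) * hs
    have e2 : (ω i)⁻¹ * q (0, i) = (ω i)⁻¹ * (l * p (0, i)) := by
      have : (ω i)⁻¹ * (l * p (0, i)) = l * ((ω i)⁻¹ * p (0, i)) := by ring
      rw [this, (hα i).2]
      linear_combination (Real.sin (α i)) * h1 + (Real.cos (α i)) * h2 -
        (ω i)⁻¹ * q (0, i) * hs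
    have e2 := mul_left_cancel₀ (inv_ne_zero (hω i).ne') e2
    fin_cases j
    · exact e2
    · exact e1
  have h1 : |l| = 1 := by rw [hqp, H_smul, hp, mul_one] at hq; exact hq
  have h2 : |1 + l| = 2 := by
    have : p + q = (1 + l) • p := by rw [hqp, add_smul, one_smul]
    rw [this, H_smul, hp, mul_one] at h
    exact h
  have : l = 1 := by
    rcases (abs_eq zero_le_one).1 h1 with h | h
    · exact h
    · rw [h] at h2; norm_num at h2
  rw [hqp, this, one_smul]

/-- Uniform convexity of the norm `H`. -/
theorem exists_H_add_lt {ω : Fin n → ℝ} (hω : ∀ i, 0 < ω i) {ε : ℝ} (hε : 0 < ε) :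
    ∃ δ : ℝ, 0 < δ ∧ ∀ p q : Phase n, H ω p = 1 → H ω q = 1 → 2 - δ < H ω (p + q) →
      ‖p - q‖ < ε := by
  -- On this compact set of separated unit pairs `H(p + q)` has a maximum, below 2 by strict
  -- convexity; `δ` is the gap.
  set K : Set (Phase n × Phase n) :=
    ({p : Phase n | H ω p = 1} ×ˢ {p : Phase n | H ω p = 1}) ∩ {x | ε ≤ ‖x.1 - x.2‖} with hK
  have hKc : IsCompact K := ((isCompact_H_eq_one hω).prod (isCompact_H_eq_one hω)).inter_right
    (isClosed_le continuous_const (by fun_prop))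
  rcases K.eq_empty_or_nonempty with he | hne
  · refine ⟨1, one_pos, fun p q hp hq _ => ?_⟩
    by_contra! hcon
    have : (p, q) ∈ K := ⟨⟨hp, hq⟩, hcon⟩
    simp [he] at this
  · have hH := continuous_H ω
    obtain ⟨⟨a, b⟩, hab, hmax⟩ := hKc.exists_isMaxOn hne
      (f := fun x => H ω (x.1 + x.2)) (by fun_prop)
    have hlt : H ω (a + b) < 2 := by
      refine lt_of_le_of_ne ?_ fun h => ?_
      · have := H_add_le ω a b
        rw [show H ω a = 1 from hab.1.1, show H ω b = 1 from hab.1.2] at this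
        linarith
      · have := eq_of_H_add_eq_two hω hab.1.1 hab.1.2 h
        have h2 : ε ≤ ‖a - b‖ := hab.2
        rw [show a = b from this, sub_self, norm_zero] at h2
        linarith
    refine ⟨2 - H ω (a + b), by linarith, fun p q hp hq h => ?_⟩
    by_contra! hcon
    have : (p, q) ∈ K := ⟨⟨hp, hq⟩, hcon⟩
    have := hmax this
    simp only [mem_ofPred_eq] at this
    linarith

/-! ### Duality between `H` and `ρ`, and momenta -/

theorem inner_eq_sum (p x : Phase n) :
    inner ℝ p x = ∑ i, (p (0, i) * x (0, i) + p (1, i) * x (1, i)) := by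
  rw [PiLp.inner_apply, Fintype.sum_prod_type, Fin.sum_univ_two, ← Finset.sum_add_distrib]
  exact Finset.sum_congr rfl fun i _ => by simp [mul_comm]

theorem inner_B (p : Phase n) : inner ℝ (B n) p = ∑ i, p (1, i) := by
  rw [inner_eq_sum]
  simp [B]

open scoped Pointwise in
theorem mem_smul_Omega {ω : Fin n → ℝ} {x : Phase n} {r : ℝ} (hr : 0 < r) :
    x ∈ r • Omega ω ↔ ∀ p : Phase n, inner ℝ p x ≤ r * H ω p := by
  rw [mem_smul_set_iff_inv_smul_mem₀ hr.ne', Omega, mem_ofPred_eq]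
  refine forall_congr' fun p => ?_
  rw [real_inner_smul_right, inv_mul_le_iff₀ hr]

theorem inner_le_H_mul_rho {ω : Fin n → ℝ} (hω : ∀ i, 0 < ω i) (p x : Phase n) :
    inner ℝ p x ≤ H ω p * rho ω x := by
  rcases eq_or_ne p 0 with rfl | hp
  · simp [H_zero]
  have hHp := H_pos hω hp
  obtain ⟨m, hm, hmH⟩ := exists_le_H hω (n := n)
  rw [← div_le_iff₀' hHp, rho, gauge_def]
  -- The infimum needs a nonempty set of radii; the lower bound `m ‖q‖ ≤ H(q)` supplies one.
  refine le_csInf ⟨(‖x‖ + 1) / m, by simp only [mem_Ioi]; positivity, ?_⟩ fun r hr => ?_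
  · rw [mem_smul_Omega (by positivity)]
    intro q
    calc inner ℝ q x ≤ ‖q‖ * ‖x‖ := real_inner_le_norm q x
      _ ≤ (H ω q / m) * (‖x‖ + 1) := by
        have h1 : ‖q‖ ≤ H ω q / m := by rw [le_div_iff₀' hm]; exact hmH q
        have h2 : ‖x‖ ≤ ‖x‖ + 1 := by linarith
        exact mul_le_mul h1 h2 (norm_nonneg _) ((norm_nonneg _).trans h1)
      _ = (‖x‖ + 1) / m * H ω q := by ring
  · rw [div_le_iff₀ hHp]
    exact (mem_smul_Omega hr.1).1 hr.2 p

theorem exists_inner_eq_rho {ω : Fin n → ℝ} (hω : ∀ i, 0 < ω i) {x : Phase n} (hx : x ≠ 0) :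
    0 < rho ω x ∧ ∃ p : Phase n, H ω p = 1 ∧ inner ℝ p x = rho ω x := by
  have hnorm : ∀ q : Phase n, q ≠ 0 → H ω ((H ω q)⁻¹ • q) = 1 := fun q hq => by
    rw [H_smul, abs_of_pos (inv_pos.2 (H_pos hω hq)), inv_mul_cancel₀ (H_pos hω hq).ne']
  obtain ⟨p, hp, hmax⟩ := (isCompact_H_eq_one hω).exists_isMaxOn ⟨_, hnorm x hx⟩
    (f := fun p => inner ℝ p x) (by fun_prop)
  have hle : ∀ q : Phase n, q ≠ 0 → inner ℝ q x ≤ inner ℝ p x * H ω q := fun q hq => by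
    have h1 : inner ℝ ((H ω q)⁻¹ • q) x ≤ inner ℝ p x := hmax (hnorm q hq)
    rwa [real_inner_smul_left, inv_mul_le_iff₀ (H_pos hω hq), mul_comm] at h1
  have hpos : 0 < inner ℝ p x := by
    have h1 := hle x hx
    have h2 : 0 < inner ℝ x x := real_inner_self_pos.2 hx
    exact pos_of_mul_pos_left (h2.trans_le h1) (H_nonneg ω x)
  have heq : inner ℝ p x = rho ω x := by
    apply le_antisymm
    · have := inner_le_H_mul_rho hω p x
      rwa [show H ω p = 1 from hp, one_mul] at this
    · refine gauge_le_of_mem hpos.le ((mem_smul_Omega hpos).2 fun q => ?_)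
      rcases eq_or_ne q 0 with rfl | hq
      · simp [H_zero]
      · exact hle q hq
  exact ⟨heq ▸ hpos, p, hp, heq⟩

theorem rho_pos {ω : Fin n → ℝ} (hω : ∀ i, 0 < ω i) {x : Phase n} (hx : x ≠ 0) : 0 < rho ω x :=
  (exists_inner_eq_rho hω hx).1

/-- At a `p` attaining `ρ(x)`, the function `H - (·, x/ρ(x))` reaches its minimum 0, so its
derivative vanishes. -/
theorem exists_isMomentum {ω : Fin n → ℝ} (hω : ∀ i, 0 < ω i) {x : Phase n} (hx : x ≠ 0) :
    ∃ p : Phase n, IsMomentum ω x p := by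
  obtain ⟨hρ, p, hp, hpx⟩ := exists_inner_eq_rho hω hx
  refine ⟨p, hp, ?_⟩
  have hp0 : p ≠ 0 := by
    rintro rfl
    rw [H_zero] at hp
    exact zero_ne_one hp
  have hd := (differentiableAt_H hω hp0).hasFDerivAt
  have hL := (innerSL ℝ ((rho ω x)⁻¹ • x)).hasFDerivAt (x := p)
  have hmin : IsLocalMin (fun q => H ω q - innerSL ℝ ((rho ω x)⁻¹ • x) q) p := by
    refine Eventually.of_forall fun q => ?_
    simp only [innerSL_apply_apply, real_inner_smul_left]
    rw [real_inner_comm p x, hpx, hp, inv_mul_cancel₀ hρ.ne', sub_self, sub_nonneg,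
      inv_mul_le_iff₀ hρ, mul_comm, real_inner_comm q x]
    exact inner_le_H_mul_rho hω q x
  have h0 := hmin.hasFDerivAt_eq_zero (hd.sub hL)
  have : fderiv ℝ (H ω) p = innerSL ℝ ((rho ω x)⁻¹ • x) := sub_eq_zero.1 h0
  rw [this] at hd
  exact hd

/-- Euler's identity: differentiate `H(t p) = |t|` at `t = 1`. -/
theorem IsMomentum.inner_eq {ω : Fin n → ℝ} (hω : ∀ i, 0 < ω i) {x p : Phase n} (hx : x ≠ 0)
    (h : IsMomentum ω x p) : inner ℝ p x = rho ω x := by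
  have hρ := rho_pos hω hx
  have h1 : HasDerivAt (fun t : ℝ => H ω (t • p)) (inner ℝ ((rho ω x)⁻¹ • x) p) 1 := by
    have hs : HasDerivAt (fun t : ℝ => t • p) p 1 := by
      simpa using (hasDerivAt_id (1 : ℝ)).smul_const p
    have hg : HasFDerivAt (H ω) (innerSL ℝ ((rho ω x)⁻¹ • x)) ((1 : ℝ) • p) := by
      rw [one_smul]
      exact h.2
    exact hg.comp_hasDerivAt 1 hs
  have h2 : HasDerivAt (fun t : ℝ => H ω (t • p)) 1 1 := by
    have := hasDerivAt_abs (one_ne_zero (α := ℝ))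
    simp only [H_smul, h.1, mul_one]
    simpa using this
  have := h1.unique h2
  rw [real_inner_smul_left, inv_mul_eq_one₀ hρ.ne'] at this
  rw [real_inner_comm, this]

/-! ### The dual flow and its observability -/

/-- The flow `ṗ = -A^* p` of the dual system. -/
def dualFlow (ω : Fin n → ℝ) (t : ℝ) (p : Phase n) : Phase n :=
  WithLp.toLp 2 fun j => if j.1 = 0
    then p (0, j.2) * Real.cos (ω j.2 * t) + ω j.2 * p (1, j.2) * Real.sin (ω j.2 * t)
    else p (1, j.2) * Real.cos (ω j.2 * t) - (ω j.2)⁻¹ * p (0, j.2) * Real.sin (ω j.2 * t)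

theorem dualFlow_fst (ω : Fin n → ℝ) (t : ℝ) (p : Phase n) (i : Fin n) :
    dualFlow ω t p (0, i) =
      p (0, i) * Real.cos (ω i * t) + ω i * p (1, i) * Real.sin (ω i * t) := rfl

theorem dualFlow_snd (ω : Fin n → ℝ) (t : ℝ) (p : Phase n) (i : Fin n) :
    dualFlow ω t p (1, i) =
      p (1, i) * Real.cos (ω i * t) - (ω i)⁻¹ * p (0, i) * Real.sin (ω i * t) := rfl

theorem dualFlow_zero (ω : Fin n → ℝ) (p : Phase n) : dualFlow ω 0 p = p := by
  ext ⟨j, i⟩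
  fin_cases j
  · simpa using dualFlow_fst ω 0 p i
  · simpa using dualFlow_snd ω 0 p i

/-- The flow rotates every pair `(η_i, ξ_i/ω_i)`, so it keeps the amplitudes. -/
theorem H_dualFlow {ω : Fin n → ℝ} (hω : ∀ i, 0 < ω i) (t : ℝ) (p : Phase n) :
    H ω (dualFlow ω t p) = H ω p := by
  rw [H, H]
  congr 1
  funext i
  rw [amplitude, amplitude, dualFlow_fst, dualFlow_snd]
  congr 1
  have h := Real.sin_sq_add_cos_sq (ω i * t)
  have hi := (hω i).ne'
  have hc : Real.cos (ω i * t) ^ 2 = 1 - Real.sin (ω i * t) ^ 2 := by linarith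
  field_simp
  ring_nf
  rw [hc]
  ring

theorem continuous_inner_B_dualFlow (ω : Fin n → ℝ) :
    Continuous fun z : ℝ × Phase n => inner ℝ (B n) (dualFlow ω z.1 z.2) := by
  simp only [inner_B, dualFlow_snd]
  fun_prop

theorem abs_inner_B_le {ω : Fin n → ℝ} (hω : ∀ i, 0 < ω i) :
    ∃ K : ℝ, 0 < K ∧ ∀ p : Phase n, H ω p = 1 → |inner ℝ (B n) p| ≤ K := by
  obtain ⟨K, hK⟩ := (isCompact_H_eq_one hω).exists_bound_of_continuousOn
    (f := fun p : Phase n => inner ℝ (B n) p) (by fun_prop)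
  exact ⟨|K| + 1, by positivity, fun p hp => (hK p hp).trans (by linarith [le_abs_self K])⟩

/-- Linear independence of the harmonics with distinct frequencies on an interval. -/
theorem eq_zero_of_sum_harmonics {ω : Fin n → ℝ} (hω : ∀ i, 0 < ω i)
    (hinj : Function.Injective ω) {a b : Fin n → ℝ}
    (h : ∀ s ∈ Ioo (0 : ℝ) 1, ∑ i, (a i * Real.cos (ω i * s) + b i * Real.sin (ω i * s)) = 0) :
    a = 0 ∧ b = 0 := by
  have hd : ∀ (u v : Fin n → ℝ) (s : ℝ),
      HasDerivAt (fun s => ∑ i, (u i * Real.cos (ω i * s) + v i * Real.sin (ω i * s)))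
        (∑ i, ((v i * ω i) * Real.cos (ω i * s) + (-u i * ω i) * Real.sin (ω i * s))) s := by
    intro u v s
    refine HasDerivAt.fun_sum fun i _ => ?_
    have h0 : HasDerivAt (fun s => ω i * s) (ω i) s := by
      simpa using (hasDerivAt_id s).const_mul (ω i)
    have := (h0.cos.const_mul (u i)).add (h0.sin.const_mul (v i))
    refine this.congr_deriv ?_
    ring
  have hstep : ∀ u v : Fin n → ℝ,
      (∀ s ∈ Ioo (0 : ℝ) 1, ∑ i, (u i * Real.cos (ω i * s) + v i * Real.sin (ω i * s)) = 0) →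
      ∀ s ∈ Ioo (0 : ℝ) 1,
        ∑ i, ((v i * ω i) * Real.cos (ω i * s) + (-u i * ω i) * Real.sin (ω i * s)) = 0 := by
    intro u v huv s hs
    refine (hd u v s).unique ((hasDerivAt_const s (0 : ℝ)).congr_of_eventuallyEq ?_)
    filter_upwards [isOpen_Ioo.mem_nhds hs] with r hr using huv r hr
  -- Two derivatives multiply the `i`-th term by `-ω_i²`. These factors are distinct, so a
  -- Vandermonde argument kills each term separately.
  have hpow : ∀ k : ℕ, ∀ s ∈ Ioo (0 : ℝ) 1,
      ∑ i, (a i * Real.cos (ω i * s) + b i * Real.sin (ω i * s)) * (-ω i ^ 2) ^ k = 0 := by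
    have : ∀ k : ℕ, ∀ s ∈ Ioo (0 : ℝ) 1, ∑ i, ((a i * (-ω i ^ 2) ^ k) * Real.cos (ω i * s) +
        (b i * (-ω i ^ 2) ^ k) * Real.sin (ω i * s)) = 0 := by
      intro k
      induction k with
      | zero => simpa using h
      | succ k ih =>
        intro s hs
        rw [← hstep _ _ (hstep _ _ ih) s hs]
        exact Finset.sum_congr rfl fun i _ => by ring
    intro k s hs
    rw [← this k s hs]
    exact Finset.sum_congr rfl fun i _ => by ring
  have hsq : Function.Injective fun i => -ω i ^ 2 := by
    intro i j hij
    have : ω i ^ 2 = ω j ^ 2 := neg_injective hij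
    exact hinj ((pow_left_inj₀ (hω i).le (hω j).le two_ne_zero).1 this)
  have hz : ∀ s ∈ Ioo (0 : ℝ) 1, ∀ i,
      a i * Real.cos (ω i * s) + b i * Real.sin (ω i * s) = 0 := fun s hs i =>
    congrFun (Matrix.eq_zero_of_forall_pow_sum_mul_pow_eq_zero hsq fun k : Fin n =>
      hpow k s hs) i
  have hab : ∀ i, a i = 0 ∧ b i = 0 := by
    intro i
    have hs : (1 / 2 : ℝ) ∈ Ioo (0 : ℝ) 1 := by norm_num
    have h1 := hz _ hs i
    have h0 : HasDerivAt (fun s => ω i * s) (ω i) (1 / 2) := by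
      simpa using (hasDerivAt_id (1 / 2 : ℝ)).const_mul (ω i)
    have h2 := ((h0.cos.const_mul (a i)).add (h0.sin.const_mul (b i))).unique
      ((hasDerivAt_const (1 / 2 : ℝ) (0 : ℝ)).congr_of_eventuallyEq (by
        filter_upwards [isOpen_Ioo.mem_nhds hs] with r hr using hz r hr i))
    have h3 : -a i * Real.sin (ω i * (1 / 2)) + b i * Real.cos (ω i * (1 / 2)) = 0 := by
      refine (mul_eq_zero.1 (?_ : ω i * _ = 0)).resolve_left (hω i).ne'
      rw [← h2]
      ring
    have hs2 := Real.sin_sq_add_cos_sq (ω i * (1 / 2))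
    constructor
    · linear_combination (Real.cos (ω i * (1 / 2))) * h1 - (Real.sin (ω i * (1 / 2))) * h3 -
        a i * hs2
    · linear_combination (Real.sin (ω i * (1 / 2))) * h1 + (Real.cos (ω i * (1 / 2))) * h3 -
        b i * hs2
  exact ⟨funext fun i => (hab i).1, funext fun i => (hab i).2⟩

/-- Uniform observability of the dual system on intervals of unit length. -/
theorem exists_observability {ω : Fin n → ℝ} (hω : ∀ i, 0 < ω i) (hinj : Function.Injective ω) :
    ∃ κ : ℝ, 0 < κ ∧ ∀ p : Phase n, H ω p = 1 →
      κ ≤ ∫ s in (0 : ℝ)..1, |inner ℝ (B n) (dualFlow ω (s - 1) p)| := by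
  have hc0 := continuous_inner_B_dualFlow ω
  have hcs : ∀ p : Phase n,
      Continuous fun s : ℝ => |inner ℝ (B n) (dualFlow ω (s - 1) p)| := fun p =>
    (hc0.comp (f := fun s : ℝ => (s - 1, p)) (by fun_prop)).abs
  have hcont : Continuous fun p : Phase n =>
      ∫ s in (0 : ℝ)..1, |inner ℝ (B n) (dualFlow ω (s - 1) p)| := by
    refine intervalIntegral.continuous_parametric_intervalIntegral_of_continuous' ?_ 0 1
    exact (hc0.comp (f := fun z : Phase n × ℝ => (z.2 - 1, z.1)) (by fun_prop)).abs
  rcases eq_empty_or_nonempty {p : Phase n | H ω p = 1} with he | hne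
  · exact ⟨1, one_pos, fun p hp => absurd (show p ∈ {p : Phase n | H ω p = 1} from hp)
      (by simp [he])⟩
  obtain ⟨q, hq, hmin⟩ := (isCompact_H_eq_one hω).exists_isMinOn hne hcont.continuousOn
  refine ⟨_, ?_, fun p hp => hmin hp⟩
  refine lt_of_le_of_ne (intervalIntegral.integral_nonneg zero_le_one fun _ _ => abs_nonneg _)
    fun h0 => ?_
  -- A zero minimum would make the continuous integrand vanish on the interval; independence of the
  -- harmonics then gives `H q = 0`.
  have hz : ∀ s ∈ Ioo (0 : ℝ) 1, inner ℝ (B n) (dualFlow ω (s - 1) q) = 0 := by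
    by_contra! hcon
    obtain ⟨s, hs, hne⟩ := hcon
    have := intervalIntegral.integral_pos zero_lt_one (hcs q).continuousOn
      (fun _ _ => abs_nonneg _) ⟨s, Ioo_subset_Icc_self hs, abs_pos.2 hne⟩
    linarith
  have hz2 : ∀ s ∈ Ioo (0 : ℝ) 1, ∑ i, ((dualFlow ω (-1) q (1, i)) * Real.cos (ω i * s) +
      (-((ω i)⁻¹ * dualFlow ω (-1) q (0, i))) * Real.sin (ω i * s)) = 0 := by
    intro s hs
    rw [← hz s hs, inner_B]
    refine Finset.sum_congr rfl fun i _ => ?_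
    rw [dualFlow_snd, dualFlow_snd, dualFlow_fst, mul_sub, mul_neg, mul_one, Real.cos_sub,
      Real.sin_sub, Real.cos_neg, Real.sin_neg]
    have := (hω i).ne'
    field_simp
    ring
  obtain ⟨h1, h2⟩ := eq_zero_of_sum_harmonics hω hinj hz2
  have hflow : dualFlow ω (-1) q = 0 := by
    ext ⟨j, i⟩
    have e1 := congrFun h1 i
    have e2 := congrFun h2 i
    fin_cases j
    · exact (mul_eq_zero.1 (neg_eq_zero.1 e2)).resolve_left (inv_ne_zero (hω i).ne')
    · exact e1
  have := H_dualFlow hω (-1) q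
  rw [hflow, H_zero, show H ω q = 1 from hq] at this
  exact zero_ne_one this

/-! ### Motions and their pairing with dual solutions -/

/-- Integration by parts for absolutely continuous functions, needed because a motion is only a
primitive of an integrable velocity. -/
theorem integral_deriv_mul_primitive {f f' w : ℝ → ℝ} {a b c : ℝ}
    (hf : ∀ t, HasDerivAt f (f' t) t) (hf' : Continuous f') (hw : IntervalIntegrable w volume a b) :
    ∫ t in a..b, (f' t * (c + ∫ s in a..t, w s) + f t * w t) =
      f b * (c + ∫ s in a..b, w s) - f a * c := by
  have hderiv : deriv f = f' := funext fun t => (hf t).deriv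
  have hfC : ContDiff ℝ 1 f := contDiff_one_iff_deriv.2
    ⟨fun t => (hf t).differentiableAt, hderiv ▸ hf'⟩
  have hfa : AbsolutelyContinuousOnInterval f a b := hfC.contDiffOn.absolutelyContinuousOnInterval
  have hca : AbsolutelyContinuousOnInterval (fun _ : ℝ => c) a b :=
    (contDiff_const (n := 1) (𝕜 := ℝ)).contDiffOn.absolutelyContinuousOnInterval
  have hga : AbsolutelyContinuousOnInterval (fun t => c + ∫ s in a..t, w s) a b :=
    hca.add (hw.absolutelyContinuousOnInterval_intervalIntegral left_mem_uIcc)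
  have h := hfa.integral_deriv_mul_eq_sub hga
  simp only [intervalIntegral.integral_same, add_zero] at h
  rw [← h]
  refine intervalIntegral.integral_congr_ae ?_
  filter_upwards [hw.ae_hasDerivAt_integral] with t ht htm
  rw [hderiv, ((ht (uIoc_subset_uIcc htm) a left_mem_uIcc).const_add c).deriv]

theorem toEuclideanLin_A_fst (ω : Fin n → ℝ) (x : Phase n) (i : Fin n) :
    Matrix.toEuclideanLin (A ω) x (0, i) = x (1, i) := by
  simp [Matrix.toLpLin_apply, Matrix.mulVec, dotProduct, Fintype.sum_prod_type, A,
    Matrix.blockDiagonal_apply]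

theorem toEuclideanLin_A_snd (ω : Fin n → ℝ) (x : Phase n) (i : Fin n) :
    Matrix.toEuclideanLin (A ω) x (1, i) = -(ω i) ^ 2 * x (0, i) := by
  simp [Matrix.toLpLin_apply, Matrix.mulVec, dotProduct, Fintype.sum_prod_type, A,
    Matrix.blockDiagonal_apply]

theorem B_fst (i : Fin n) : B n (0, i) = 0 := by simp [B]

theorem B_snd (i : Fin n) : B n (1, i) = 1 := by simp [B]

/-- The right-hand side of the controlled system. -/
def velocity (ω : Fin n → ℝ) (U : ℝ) (x : ℝ → Phase n) (v : ℝ → ℝ) (s : ℝ) : Phase n :=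
  Matrix.toEuclideanLin (A ω) (x s) + (U * v s) • B n

theorem intervalIntegrable_of_abs_le_one {v : ℝ → ℝ} {a b : ℝ} (hab : a ≤ b) (hv : Measurable v)
    (hle : ∀ᵐ t, t ∈ Icc a b → |v t| ≤ 1) : IntervalIntegrable v volume a b := by
  rw [intervalIntegrable_iff_integrableOn_Icc_of_le hab]
  refine Measure.integrableOn_of_bounded (M := 1) (by simp) hv.aestronglyMeasurable ?_
  exact (ae_restrict_iff' measurableSet_Icc).2 hle

theorem intervalIntegrable_velocity {ω : Fin n → ℝ} {U : ℝ} {x : ℝ → Phase n} {v : ℝ → ℝ}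
    {a b : ℝ} (hab : a ≤ b) (hx : ContinuousOn x (Icc a b))
    (hv : IntervalIntegrable v volume a b) :
    IntervalIntegrable (velocity ω U x v) volume a b := by
  refine IntervalIntegrable.add ?_ ?_
  · refine ContinuousOn.intervalIntegrable ?_
    rw [uIcc_of_le hab]
    exact (Matrix.toEuclideanLin (A ω)).continuous_of_finiteDimensional.comp_continuousOn hx
  · exact ⟨(hv.const_mul U).1.smul_const (B n), (hv.const_mul U).2.smul_const (B n)⟩

theorem IsMotion.mono {ω : Fin n → ℝ} {U : ℝ} {x : ℝ → Phase n} {a b c d : ℝ}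
    (h : IsMotion ω U x a b) (hac : a ≤ c) (hcd : c ≤ d) (hdb : d ≤ b) :
    IsMotion ω U x c d := by
  obtain ⟨hx, v, hvm, hvf, hxv⟩ := h
  have hab : a ≤ b := hac.trans (hcd.trans hdb)
  have hint : IntervalIntegrable (velocity ω U x v) volume a b :=
    intervalIntegrable_velocity hab hx (intervalIntegrable_of_abs_le_one hab hvm (by
      filter_upwards [hvf] with t ht htm using (ht htm).1))
  have hsub : Icc c d ⊆ Icc a b := Icc_subset_Icc hac hdb
  refine ⟨hx.mono hsub, v, hvm, ?_, fun t ht => ?_⟩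
  · filter_upwards [hvf] with t h1 h2 using h1 (hsub h2)
  · have h1 := hxv t (hsub ht)
    have h2 := hxv c ⟨hac, hcd.trans hdb⟩
    have h3 := intervalIntegral.integral_add_adjacent_intervals
      (hint.mono_set (c := a) (d := c) (by
        rw [uIcc_of_le hab, uIcc_of_le hac]; exact Icc_subset_Icc le_rfl (hcd.trans hdb)))
      (hint.mono_set (c := c) (d := t) (by
        rw [uIcc_of_le hab, uIcc_of_le ht.1]; exact Icc_subset_Icc hac (ht.2.trans hdb)))
    simp only [velocity] at h3
    rw [h1, h2, ← h3, add_assoc]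

/-- Variation of the pairing of a motion with a solution of the dual system. -/
theorem inner_dualFlow_sub {ω : Fin n → ℝ} (hω : ∀ i, 0 < ω i) {U : ℝ} {x : ℝ → Phase n}
    {v : ℝ → ℝ} {a b : ℝ} (hab : a ≤ b) (hx : ContinuousOn x (Icc a b))
    (hv : IntervalIntegrable v volume a b)
    (hxv : ∀ t ∈ Icc a b, x t = x a + ∫ s in a..t, velocity ω U x v s) (τ : ℝ) (p : Phase n) :
    inner ℝ (dualFlow ω (b - τ) p) (x b) - inner ℝ (dualFlow ω (a - τ) p) (x a) =
      ∫ t in a..b, U * v t * inner ℝ (B n) (dualFlow ω (t - τ) p) := by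
  have hw := intervalIntegrable_velocity (ω := ω) (U := U) hab hx hv
  have hwj : ∀ j, IntervalIntegrable (fun t => velocity ω U x v t j) volume a b := fun j =>
    ⟨(EuclideanSpace.proj (𝕜 := ℝ) j).integrable_comp hw.1,
      (EuclideanSpace.proj (𝕜 := ℝ) j).integrable_comp hw.2⟩
  have hxj : ∀ j, ∀ t ∈ Icc a b, x t j = x a j + ∫ s in a..t, velocity ω U x v s j := by
    intro j t ht
    have hwt : IntervalIntegrable (velocity ω U x v) volume a t := hw.mono_set (by
      rw [uIcc_of_le hab, uIcc_of_le ht.1]; exact Icc_subset_Icc le_rfl ht.2)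
    have := (EuclideanSpace.proj (𝕜 := ℝ) j :
      Phase n →L[ℝ] ℝ).intervalIntegral_comp_comm hwt
    have h2 : (x t) j = (x a) j + (∫ s in a..t, velocity ω U x v s) j := by
      conv_lhs => rw [hxv t ht]
      rfl
    rw [h2]
    congr 1
    exact this.symm
  have hflow : ∀ j t, HasDerivAt (fun t => dualFlow ω (t - τ) p j)
      (if j.1 = 0 then ω j.2 ^ 2 * dualFlow ω (t - τ) p (1, j.2)
        else -dualFlow ω (t - τ) p (0, j.2)) t := by
    rintro ⟨j, i⟩ t
    have h0 : HasDerivAt (fun s => ω i * (s - τ)) (ω i) t := by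
      simpa using ((hasDerivAt_id t).sub_const τ).const_mul (ω i)
    have hi := (hω i).ne'
    fin_cases j
    · have := (h0.cos.const_mul (p (0, i))).add (h0.sin.const_mul (ω i * p (1, i)))
      refine this.congr_deriv ?_
      simp only [Fin.zero_eta, if_true, dualFlow_snd]
      field_simp
      ring
    · have := (h0.cos.const_mul (p (1, i))).sub (h0.sin.const_mul ((ω i)⁻¹ * p (0, i)))
      refine this.congr_deriv ?_
      simp only [Fin.mk_one, one_ne_zero, if_false, dualFlow_fst]
      field_simp
      ring
  have hcont : ∀ j, Continuous fun t => dualFlow ω (t - τ) p j := fun j =>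
    continuous_iff_continuousAt.2 fun t => (hflow j t).continuousAt
  have hcont' : ∀ j : Fin 2 × Fin n, Continuous fun t =>
      (if j.1 = 0 then ω j.2 ^ 2 * dualFlow ω (t - τ) p (1, j.2)
        else -dualFlow ω (t - τ) p (0, j.2)) := by
    intro j
    have h1 := hcont (1, j.2)
    have h2 := hcont (0, j.2)
    split_ifs <;> fun_prop
  have hparts : ∀ j : Fin 2 × Fin n,
      ∫ t in a..b, ((if j.1 = 0 then ω j.2 ^ 2 * dualFlow ω (t - τ) p (1, j.2)
        else -dualFlow ω (t - τ) p (0, j.2)) * x t j +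
          dualFlow ω (t - τ) p j * velocity ω U x v t j) =
      dualFlow ω (b - τ) p j * x b j - dualFlow ω (a - τ) p j * x a j := by
    intro j
    rw [hxj j b ⟨hab, le_rfl⟩, ← integral_deriv_mul_primitive (hflow j) (hcont' j) (hwj j)]
    refine intervalIntegral.integral_congr fun t ht => ?_
    rw [uIcc_of_le hab] at ht
    simp only [hxj j t ht]
  have hI : ∀ j ∈ (Finset.univ : Finset (Fin 2 × Fin n)), IntervalIntegrable (fun t =>
      (if j.1 = 0 then ω j.2 ^ 2 * dualFlow ω (t - τ) p (1, j.2)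
        else -dualFlow ω (t - τ) p (0, j.2)) * x t j +
          dualFlow ω (t - τ) p j * velocity ω U x v t j) volume a b := by
    intro j _
    refine IntervalIntegrable.add ?_ ((hwj j).continuousOn_mul (hcont j).continuousOn)
    refine ContinuousOn.intervalIntegrable ?_
    rw [uIcc_of_le hab]
    exact (hcont' j).continuousOn.mul
      ((EuclideanSpace.proj (𝕜 := ℝ) j : Phase n →L[ℝ] ℝ).continuous.comp_continuousOn hx)
  have hsum := intervalIntegral.integral_finsetSum hI
  rw [Finset.sum_congr rfl fun j _ => hparts j] at hsum
  have hlhs : inner ℝ (dualFlow ω (b - τ) p) (x b) - inner ℝ (dualFlow ω (a - τ) p) (x a) =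
      ∑ j, (dualFlow ω (b - τ) p j * x b j - dualFlow ω (a - τ) p j * x a j) := by
    rw [PiLp.inner_apply, PiLp.inner_apply, ← Finset.sum_sub_distrib]
    exact Finset.sum_congr rfl fun j _ => by simp [mul_comm]
  rw [hlhs, ← hsum]
  refine intervalIntegral.integral_congr fun t _ => ?_
  simp only []
  -- The terms containing `A` cancel oscillator by oscillator; only the control term survives.
  rw [Fintype.sum_prod_type, Fin.sum_univ_two, inner_B, ← Finset.sum_add_distrib, Finset.mul_sum]
  refine Finset.sum_congr rfl fun i _ => ?_
  simp only [velocity, PiLp.add_apply, PiLp.smul_apply, toEuclideanLin_A_fst,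
    toEuclideanLin_A_snd, B_fst, B_snd, smul_eq_mul, if_true, one_ne_zero, if_false]
  ring

theorem rho_zero (ω : Fin n → ℝ) : rho ω 0 = 0 := gauge_zero

theorem abs_inner_dualFlow_sub_le {ω : Fin n → ℝ} (hω : ∀ i, 0 < ω i) {K : ℝ}
    (hK : ∀ p : Phase n, H ω p = 1 → |inner ℝ (B n) p| ≤ K) {x : ℝ → Phase n}
    {a b : ℝ} (hab : a ≤ b) (hb1 : b ≤ a + 1) (h : IsMotion ω 1 x a b) (τ : ℝ) {p : Phase n}
    (hp : H ω p = 1) :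
    |inner ℝ (dualFlow ω (b - τ) p) (x b) - inner ℝ (dualFlow ω (a - τ) p) (x a)| ≤ K := by
  obtain ⟨hx, v, hvm, hvf, hxv⟩ := h
  have hv1 : ∀ᵐ t, t ∈ Icc a b → |v t| ≤ 1 := by
    filter_upwards [hvf] with t ht htm using (ht htm).1
  have hK0 : 0 ≤ K := (abs_nonneg _).trans (hK p hp)
  rw [inner_dualFlow_sub hω hab hx (intervalIntegrable_of_abs_le_one hab hvm hv1) hxv τ p]
  have := intervalIntegral.norm_integral_le_of_norm_le_const_ae (a := a) (b := b) (C := K)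
    (f := fun t => 1 * v t * inner ℝ (B n) (dualFlow ω (t - τ) p)) (by
      filter_upwards [hv1] with t ht htm
      rw [uIoc_of_le hab] at htm
      rw [one_mul, Real.norm_eq_abs, abs_mul]
      calc |v t| * _ ≤ 1 * K := by
            gcongr
            · exact ht (Ioc_subset_Icc_self htm)
            · exact hK _ (by rw [H_dualFlow hω, hp])
        _ = K := one_mul K)
  refine this.trans ?_
  rw [abs_of_nonneg (by linarith)]
  calc K * (b - a) ≤ K * 1 := by gcongr; linarith
    _ = K := mul_one K

/-! ### Decrease of `ρ` and existence of admissible constants -/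

/-- Far from the origin the polar radius drops by a definite amount in a unit of time. -/
theorem exists_rho_drop {ω : Fin n → ℝ} (hω : ∀ i, 0 < ω i) (hinj : Function.Injective ω) :
    ∃ C κ : ℝ, 0 < C ∧ 0 < κ ∧ ∀ (a : ℝ) (x : ℝ → Phase n), IsMotion ω 1 x a (a + 1) →
      (∀ t ∈ Icc a (a + 1), C ≤ rho ω (x t)) → rho ω (x (a + 1)) ≤ rho ω (x a) - κ := by
  obtain ⟨κ, hκ, hobs⟩ := exists_observability hω hinj
  obtain ⟨K, hK0, hK⟩ := abs_inner_B_le hω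
  have hB : 0 < ‖B n‖ + 1 := by positivity
  obtain ⟨δ, hδ, hconv⟩ := exists_H_add_lt hω (ε := κ / (4 * (‖B n‖ + 1))) (by positivity)
  -- This threshold yields `2K < δ ρ`. Of the observed amount `κ`, half is spent on replacing the
  -- true momentum by the transported one.
  refine ⟨2 * K / δ + 1, κ / 2, by positivity, by positivity, fun a x hmot hC => ?_⟩
  have hab : a ≤ a + 1 := by linarith
  have hne : ∀ t ∈ Icc a (a + 1), x t ≠ 0 := by
    intro t ht h0
    have h1 := hC t ht
    rw [h0, rho_zero] at h1
    have : 0 < 2 * K / δ + 1 := by positivity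
    linarith
  have hb : a + 1 ∈ Icc a (a + 1) := ⟨hab, le_rfl⟩
  obtain ⟨p, hp⟩ := exists_isMomentum hω (hne _ hb)
  have hPb : inner ℝ (dualFlow ω (a + 1 - (a + 1)) p) (x (a + 1)) = rho ω (x (a + 1)) := by
    rw [sub_self, dualFlow_zero, hp.inner_eq hω (hne _ hb)]
  -- Let `P` be `p` transported to time `s`. Going forward with `q` and back with `p` costs `K`
  -- each, so `(P, x(s)) ≥ ρ(x(s)) - 2K`. Hence `H(q + P) > 2 - δ`, and uniform convexity applies.
  have hclose : ∀ s ∈ Icc a (a + 1), ∀ q, IsMomentum ω (x s) q →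
      |inner ℝ (B n) (dualFlow ω (s - (a + 1)) p) - inner ℝ (B n) q| ≤ κ / 4 := by
    intro s hs q hq
    have hmot' := hmot.mono hs.1 hs.2 le_rfl
    have h1 := abs_le.1 (abs_inner_dualFlow_sub_le hω hK hs.2 (by linarith [hs.1]) hmot' (a + 1)
      hp.1)
    have h2 := abs_le.1 (abs_inner_dualFlow_sub_le hω hK hs.2 (by linarith [hs.1]) hmot' s hq.1)
    rw [hPb] at h1
    rw [sub_self, dualFlow_zero, hq.inner_eq hω (hne s hs)] at h2
    have h3 := inner_le_H_mul_rho hω (dualFlow ω (a + 1 - s) q) (x (a + 1))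
    rw [H_dualFlow hω, hq.1, one_mul] at h3
    have h4 := inner_le_H_mul_rho hω (q + dualFlow ω (s - (a + 1)) p) (x s)
    rw [inner_add_left, hq.inner_eq hω (hne s hs)] at h4
    have hρ := rho_pos hω (hne s hs)
    have h5 : 2 * K < δ * rho ω (x s) := by
      have : 2 * K / δ < rho ω (x s) := by linarith [hC s hs]
      rwa [div_lt_iff₀' hδ] at this
    have h6 : 2 - δ < H ω (q + dualFlow ω (s - (a + 1)) p) := by
      by_contra! hcon
      have := mul_le_mul_of_nonneg_right hcon hρ.le
      linarith [h1.2, h2.1]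
    have h7 := hconv q _ hq.1 (by rw [H_dualFlow hω, hp.1]) h6
    rw [← inner_sub_right]
    calc |inner ℝ (B n) (dualFlow ω (s - (a + 1)) p - q)|
        ≤ ‖B n‖ * ‖dualFlow ω (s - (a + 1)) p - q‖ := abs_real_inner_le_norm _ _
      _ ≤ (‖B n‖ + 1) * (κ / (4 * (‖B n‖ + 1))) := by
        rw [norm_sub_rev]
        gcongr
        linarith
      _ = κ / 4 := by field_simp
  obtain ⟨hx, v, hvm, hvf, hxv⟩ := hmot
  have hvi : IntervalIntegrable v volume a (a + 1) :=
    intervalIntegrable_of_abs_le_one hab hvm (by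
      filter_upwards [hvf] with t ht htm using (ht htm).1)
  have hvar := inner_dualFlow_sub hω hab hx hvi hxv (a + 1) p
  rw [hPb] at hvar
  have hPc : Continuous fun t => inner ℝ (B n) (dualFlow ω (t - (a + 1)) p) :=
    (continuous_inner_B_dualFlow ω).comp (f := fun t : ℝ => (t - (a + 1), p)) (by fun_prop)
  -- With `β`, `γ` the pairings of `B` with the transported and a true momentum, `vβ = -|γ| + v(β -
  -- γ) ≤ κ/2 - |β|`: the error `κ/4` enters twice.
  have hle : ∫ t in a..(a + 1), 1 * v t * inner ℝ (B n) (dualFlow ω (t - (a + 1)) p) ≤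
      ∫ t in a..(a + 1), (κ / 2 - |inner ℝ (B n) (dualFlow ω (t - (a + 1)) p)|) := by
    refine intervalIntegral.integral_mono_ae_restrict hab
      ((hvi.const_mul 1).mul_continuousOn hPc.continuousOn)
      ((continuous_const.sub hPc.abs).intervalIntegrable _ _) ?_
    refine (ae_restrict_iff' measurableSet_Icc).2 ?_
    filter_upwards [hvf] with t ht htm
    obtain ⟨hv1, hv2⟩ := ht htm
    obtain ⟨q, hq⟩ := exists_isMomentum hω (hne t htm)
    have h1 := hclose t htm q hq
    have h2 := hv2 q hq
    set β := inner ℝ (B n) (dualFlow ω (t - (a + 1)) p)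
    set γ := inner ℝ (B n) q
    have h3 : v t * (β - γ) ≤ κ / 4 := by
      calc v t * (β - γ) ≤ |v t * (β - γ)| := le_abs_self _
        _ = |v t| * |β - γ| := abs_mul _ _
        _ ≤ 1 * (κ / 4) := by gcongr
        _ = κ / 4 := one_mul _
    have h4 : |β| - |γ| ≤ |β - γ| := abs_sub_abs_le_abs_sub β γ
    have h5 : 1 * v t * β = v t * γ + v t * (β - γ) := by ring
    rw [h5, h2]
    linarith
  rw [intervalIntegral.integral_sub (by simp) (hPc.abs.intervalIntegrable _ _),
    intervalIntegral.integral_const] at hle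
  have hshift : ∫ t in a..(a + 1), |inner ℝ (B n) (dualFlow ω (t - (a + 1)) p)| =
      ∫ s in (0 : ℝ)..1, |inner ℝ (B n) (dualFlow ω (s - 1) p)| := by
    have := intervalIntegral.integral_comp_sub_right (a := a) (b := a + 1)
      (fun s => |inner ℝ (B n) (dualFlow ω (s - 1) p)|) a
    rw [sub_self, add_sub_cancel_left] at this
    rw [← this]
    refine intervalIntegral.integral_congr fun t _ => ?_
    rw [sub_sub]
  rw [hshift] at hle
  have h1 := hobs p hp.1
  have h2 := inner_le_H_mul_rho hω (dualFlow ω (a - (a + 1)) p) (x a)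
  rw [H_dualFlow hω, hp.1, one_mul] at h2
  simp only [add_sub_cancel_left, one_smul] at hle
  linarith

theorem exists_areEfficiencyConstants {ω : Fin n → ℝ} (hω : ∀ i, 0 < ω i)
    (hinj : Function.Injective ω) :
    ∃ C c : ℝ, 0 < C ∧ 0 < c ∧ AreEfficiencyConstants ω C c := by
  obtain ⟨C, κ, hC, hκ, hdrop⟩ := exists_rho_drop hω hinj
  refine ⟨C, κ⁻¹, hC, inv_pos.2 hκ, ?_⟩
  rintro T a M N x hmot hdom rfl rfl
  have key : ∀ k : ℕ, k ≤ T → rho ω (x (a + k)) ≤ rho ω (x a) - k * κ := by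
    intro k
    induction k with
    | zero => simp
    | succ k ih =>
      intro hk
      have hkT : (k : ℝ) + 1 ≤ T := by exact_mod_cast hk
      have hk0 : (0 : ℝ) ≤ k := Nat.cast_nonneg k
      have h1 := hdrop (a + k) x (hmot.mono (by linarith) (by linarith) (by linarith))
        fun t ht => hdom t ⟨by linarith [ht.1], by linarith [ht.2]⟩
      have h2 := ih (Nat.le_of_succ_le hk)
      push_cast
      rw [← add_assoc]
      linarith
  have := key T le_rfl
  rw [inv_mul_eq_div, le_div_iff₀ hκ]
  linarith

/-! ### Dilation and time reversal -/

theorem rho_smul (ω : Fin n → ℝ) {r : ℝ} (hr : 0 ≤ r) (x : Phase n) :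
    rho ω (r • x) = r * rho ω x := by
  rw [rho, gauge_smul_of_nonneg hr, smul_eq_mul]
  rfl

theorem isMomentum_smul {ω : Fin n → ℝ} {r : ℝ} (hr : 0 < r) {x p : Phase n} :
    IsMomentum ω (r • x) p ↔ IsMomentum ω x p := by
  rw [IsMomentum, IsMomentum, rho_smul ω hr.le, smul_smul, mul_inv, mul_right_comm,
    inv_mul_cancel₀ hr.ne', one_mul]

/-- The momentum equation sees only `x/ρ(x)`, which positive dilations fix. -/
theorem feedback_smul {ω : Fin n → ℝ} {r : ℝ} (hr : 0 < r) (x : Phase n) :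
    feedback ω (r • x) = feedback ω x := by
  simp only [feedback, isMomentum_smul hr]

theorem IsMotion.smul {ω : Fin n → ℝ} {U : ℝ} {x : ℝ → Phase n} {a b : ℝ}
    (h : IsMotion ω U x a b) {r : ℝ} (hr : 0 < r) :
    IsMotion ω (r * U) (fun t => r • x t) a b := by
  obtain ⟨hx, v, hvm, hvf, hxv⟩ := h
  refine ⟨hx.const_smul r, v, hvm, ?_, fun t ht => ?_⟩
  · simpa only [feedback_smul hr] using hvf
  · simp only []
    conv_lhs => rw [hxv t ht]
    rw [smul_add, ← intervalIntegral.integral_smul]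
    simp only [smul_add, map_smul, smul_smul, mul_assoc]

/-- The reflection of velocities, which reverses time. -/
def reflect (n : ℕ) : Phase n →L[ℝ] Phase n :=
  LinearMap.toContinuousLinearMap
    { toFun := fun x => WithLp.toLp 2 fun j => if j.1 = 0 then x j else -x j
      map_add' := fun x y => by
        ext j
        simp only [PiLp.add_apply]
        split_ifs <;> ring
      map_smul' := fun r x => by
        ext j
        simp only [PiLp.smul_apply, smul_eq_mul, RingHom.id_apply]
        split_ifs <;> ring }

theorem reflect_fst (x : Phase n) (i : Fin n) : reflect n x (0, i) = x (0, i) := rfl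

theorem reflect_snd (x : Phase n) (i : Fin n) : reflect n x (1, i) = -x (1, i) := rfl

theorem reflect_reflect (x : Phase n) : reflect n (reflect n x) = x := by
  ext ⟨j, i⟩
  fin_cases j
  · rfl
  · exact neg_neg _

theorem inner_reflect (p x : Phase n) : inner ℝ (reflect n p) x = inner ℝ p (reflect n x) := by
  simp only [inner_eq_sum, reflect_fst, reflect_snd, neg_mul, mul_neg]

theorem inner_B_reflect (p : Phase n) : inner ℝ (B n) (reflect n p) = -inner ℝ (B n) p := by
  simp only [inner_B, reflect_snd, Finset.sum_neg_distrib]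

theorem H_reflect (ω : Fin n → ℝ) (p : Phase n) : H ω (reflect n p) = H ω p := by
  rw [H, H]
  congr 1
  funext i
  rw [amplitude, amplitude, reflect_fst, reflect_snd, neg_sq]

theorem reflect_mem_Omega {ω : Fin n → ℝ} {x : Phase n} :
    reflect n x ∈ Omega ω ↔ x ∈ Omega ω := by
  have key : ∀ y : Phase n, y ∈ Omega ω → reflect n y ∈ Omega ω := fun y hy p => by
    rw [← inner_reflect, ← H_reflect]
    exact hy _
  exact ⟨fun h => by simpa only [reflect_reflect] using key _ h, key x⟩

theorem rho_reflect (ω : Fin n → ℝ) (x : Phase n) : rho ω (reflect n x) = rho ω x := by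
  simp only [rho, gauge_def', ← map_smul, reflect_mem_Omega]

theorem IsMomentum.reflect {ω : Fin n → ℝ} {x p : Phase n} (h : IsMomentum ω x p) :
    IsMomentum ω (reflect n x) (reflect n p) := by
  refine ⟨(H_reflect ω p).trans h.1, ?_⟩
  have h1 : HasFDerivAt (H ω) (innerSL ℝ ((rho ω x)⁻¹ • x))
      (Oscillators.reflect n (Oscillators.reflect n p)) := by
    rw [reflect_reflect]
    exact h.2
  have h2 := h1.comp _ (Oscillators.reflect n).hasFDerivAt
  have h3 : H ω ∘ Oscillators.reflect n = H ω := funext (H_reflect ω)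
  have h4 : (innerSL ℝ ((rho ω x)⁻¹ • x)).comp (Oscillators.reflect n) =
      innerSL ℝ ((rho ω x)⁻¹ • Oscillators.reflect n x) := by
    ext q
    rw [ContinuousLinearMap.comp_apply, innerSL_apply_apply, innerSL_apply_apply, ← map_smul,
      inner_reflect]
  rw [h3, h4] at h2
  rw [rho_reflect]
  exact h2

/-- Reflection carries momenta to momenta and reverses the sign of their pairing with `B`. -/
theorem neg_mem_feedback_reflect {ω : Fin n → ℝ} {x : Phase n} {v : ℝ} (h : v ∈ feedback ω x) :
    -v ∈ feedback ω (reflect n x) := by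
  refine ⟨(abs_neg v).trans_le h.1, fun p hp => ?_⟩
  have hp' := hp.reflect
  rw [reflect_reflect] at hp'
  have := h.2 _ hp'
  rw [inner_B_reflect, abs_neg] at this
  linarith

theorem reflect_velocity (ω : Fin n → ℝ) (x : Phase n) (u : ℝ) :
    -reflect n (Matrix.toEuclideanLin (A ω) x + u • B n) =
      Matrix.toEuclideanLin (A ω) (reflect n x) + u • B n := by
  ext ⟨j, i⟩
  fin_cases j
  · simp [reflect_fst, reflect_snd, toEuclideanLin_A_fst, B_fst]
  · simp [reflect_fst, reflect_snd, toEuclideanLin_A_snd, B_snd, add_comm]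

/-- The reversed motion is driven by the same force `U v`, since `-R(Ax + uB) = ARx + uB` for the
reflection `R`. The feedback values change sign, so `U` must as well. -/
theorem IsMotion.reverse {ω : Fin n → ℝ} {U : ℝ} {x : ℝ → Phase n} {a b : ℝ} (hab : a ≤ b)
    (h : IsMotion ω U x a b) :
    IsMotion ω (-U) (fun t => reflect n (x (a + b - t))) a b := by
  obtain ⟨hx, v, hvm, hvf, hxv⟩ := h
  have hmaps : MapsTo (fun t => a + b - t) (Icc a b) (Icc a b) := fun t ht =>
    ⟨by linarith [ht.2], by linarith [ht.1]⟩
  have hint : IntervalIntegrable (velocity ω U x v) volume a b :=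
    intervalIntegrable_velocity hab hx (intervalIntegrable_of_abs_le_one hab hvm (by
      filter_upwards [hvf] with t ht htm using (ht htm).1))
  refine ⟨(reflect n).continuous.comp_continuousOn (hx.comp (by fun_prop) hmaps),
    fun t => -v (a + b - t), (hvm.comp (by fun_prop)).neg, ?_, fun t ht => ?_⟩
  · have := (Measure.measurePreserving_sub_left volume (a + b)).quasiMeasurePreserving.ae hvf
    filter_upwards [this] with t h1 h2
    exact neg_mem_feedback_reflect (h1 (hmaps h2))
  · have hs := hmaps ht
    have hsub : IntervalIntegrable (velocity ω U x v) volume (a + b - t) b :=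
      hint.mono_set (by rw [uIcc_of_le hab, uIcc_of_le hs.2]; exact Icc_subset_Icc hs.1 le_rfl)
    have hpre : IntervalIntegrable (velocity ω U x v) volume a (a + b - t) :=
      hint.mono_set (by rw [uIcc_of_le hab, uIcc_of_le hs.1]; exact Icc_subset_Icc le_rfl hs.2)
    have h1 := hxv _ hs
    have h2 := hxv b ⟨hab, le_rfl⟩
    have h3 := intervalIntegral.integral_add_adjacent_intervals hpre hsub
    have h4 : x (a + b - t) = x b - ∫ s in (a + b - t)..b, velocity ω U x v s := by
      simp only [velocity] at h3 ⊢
      rw [h1, h2, ← h3]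
      abel
    have h5 : ∫ s in a..t, (Matrix.toEuclideanLin (A ω) (reflect n (x (a + b - s))) +
        (-U * -v (a + b - s)) • B n) = -reflect n (∫ s in (a + b - t)..b, velocity ω U x v s) := by
      have := (reflect n).intervalIntegral_comp_comm hsub
      rw [← this, ← intervalIntegral.integral_neg]
      have h6 := intervalIntegral.integral_comp_sub_left (a := a) (b := t)
        (fun s => -reflect n (velocity ω U x v s)) (a + b)
      rw [add_sub_cancel_left] at h6
      rw [← h6]
      refine intervalIntegral.integral_congr fun s _ => ?_
      simp only [velocity]
      rw [reflect_velocity, neg_mul_neg]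
    simp only [add_sub_cancel_left]
    rw [h5, h4, map_sub, sub_eq_add_neg]

end Oscillators

end

theorem theorem3 (n : ℕ) (hn : 1 ≤ n) (ω : Fin n → ℝ)
    (hω : ∀ i, 0 < ω i) (hinj : Function.Injective ω) :
    (∃ C c : ℝ, 0 < C ∧ 0 < c ∧ Oscillators.AreEfficiencyConstants ω C c) ∧
    ∀ C c : ℝ, 0 < C → 0 < c → Oscillators.AreEfficiencyConstants ω C c →
      ∀ (U : ℝ), U ≠ 0 → |U| ≤ 1 →
      ∀ (T : ℕ) (a M N : ℝ) (x : ℝ → Oscillators.Phase n),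
        Oscillators.IsMotion ω U x a (a + T) →
        (∀ t ∈ Set.Icc a (a + T), |U| * C ≤ Oscillators.rho ω (x t)) →
        Oscillators.rho ω (x a) = M → Oscillators.rho ω (x (a + T)) = N →
        (T : ℝ) ≤ c / U * (M - N) := by
  refine ⟨Oscillators.exists_areEfficiencyConstants hω hinj, ?_⟩
  rintro C c - - hadm U hU - T a M N x hmot hdom rfl rfl
  have hT : (0 : ℝ) ≤ T := Nat.cast_nonneg T
  rcases lt_or_gt_of_ne hU with hneg | hpos
  -- Reversal exchanges the end levels, and `c/(-U) · (N - M)` is the required bound.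
  · have hr : 0 < (-U)⁻¹ := inv_pos.2 (neg_pos.2 hneg)
    have hmot' := (hmot.reverse (by linarith)).smul hr
    rw [inv_mul_cancel₀ (neg_pos.2 hneg).ne'] at hmot'
    have h := hadm T a _ _ _ hmot' (fun t ht => ?_) rfl rfl
    · simp only [Oscillators.rho_smul ω hr.le, Oscillators.rho_reflect, add_sub_cancel_left,
        add_sub_cancel_right] at h
      refine h.trans_eq ?_
      field_simp
      ring
    · rw [Oscillators.rho_smul ω hr.le, Oscillators.rho_reflect]
      have h1 := hdom (a + (a + T) - t) ⟨by linarith [ht.2], by linarith [ht.1]⟩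
      rw [abs_of_neg hneg] at h1
      rwa [le_inv_mul_iff₀ (neg_pos.2 hneg)]
  · have hr : 0 < U⁻¹ := inv_pos.2 hpos
    have hmot' := hmot.smul hr
    rw [inv_mul_cancel₀ hU] at hmot'
    have h := hadm T a _ _ _ hmot' (fun t ht => ?_) rfl rfl
    · simp only [Oscillators.rho_smul ω hr.le] at h
      refine h.trans_eq ?_
      field_simp
    · rw [Oscillators.rho_smul ω hr.le]
      have h1 := hdom t ht
      rw [abs_of_pos hpos] at h1
      rwa [le_inv_mul_iff₀ hpos]
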